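/- Let $r\ge 1$ and $0\le p<n$ be integers, let $x^{(1)},\dots,x^{(n)}\in\mathbb{R}^r$ be distinct points, and let $f_1,\dots,f_p:\mathbb{R}^r\to\mathbb{R}$ be functions such that the $n\times p$ matrix $H=(f_j(x^{(i)}))_{i,j}$ has rank $p$. For a correlation kernel $K:[0,\infty)\to\mathbb{R}$ and $\theta>0$ let $\Sigma_\theta$ be the $n\times n$ matrix with entries $K(\|x^{(i)}-x^{(j)}\|/\theta)$, where $\|\cdot\|$ is the Euclidean norm, and let $$Q_\theta=I_n-H\left(H^\top\Sigma_\theta^{-1}H\right)^{-1}H^\top\Sigma_\theta^{-1}\qquad(Q_\theta=I_n\text{ if }p=0).$$ The marginal reference prior of $\theta$ is the function $\pi$ on $(0,\infty)$, defined up to a positive multiplicative constant, given by $$\pi(\theta)\propto\sqrt{\operatorname{Tr}\left[\left\{\left(\tfrac{d}{d\theta}\Sigma_\theta\right)\Sigma_\theta^{-1}Q_\theta\right\}^2\right]-\frac1{n-p}\left[\operatorname{Tr}\left\{\left(\tfrac{d}{d\theta}\Sigma_\theta\right)\Sigma_\theta^{-1}Q_\theta\right\}\right]^2}.$$ Consider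 the following kernels, where $\mathcal{K}_\nu$ is the modified Bessel function of the second kind: - Matérn with smoothness $\nu\ge1$: $K(d)=\Gamma(\nu)^{-1}2^{1-\nu}(2\sqrt\nu\,d)^\nu\mathcal{K}_\nu(2\sqrt\nu\,d)$ for $d>0$, and $K(0)=1$; - Rational Quadratic with parameter $\nu>0$: $K(d)=(1+d^2)^{-\nu}$; - Squared Exponential: $K(d)=\exp(-d^2)$. For each of them $\pi$ is well defined: for every $\theta>0$ the matrix $\Sigma_\theta$ is positive definite and differentiable in $\theta$, and the quantity under the square root is nonnegative. Moreover: 1. As $\theta\to0^+$, $\pi(\theta)=o(1)$ for Matérn kernels and for the Squared Exponential kernel, and $\pi(\theta)=O(\theta^{\nu-1})$ for Rational Quadratic kernels. 2. As $\theta\to+\infty$, $\pi(\theta)=O(\theta^{-1})$ for Matérn kernels, $\pi(\theta)=o(1)$ for Rational Quadratic kernels, and $\pi(\theta)=O(\theta)$ for the Squared Exponential kernel. -/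

import Mathlib

open Filter Topology Asymptotics
open scoped Matrix

noncomputable section

/-- The modified Bessel function of the second kind `𝒦_ν(z)`, for real order `ν` and `z > 0`, given
by the (absolutely convergent) integral `∫₀^∞ exp (-z cosh t) cosh (ν t) dt`. -/
def besselK (ν z : ℝ) : ℝ :=
  ∫ t in Set.Ioi (0 : ℝ), Real.exp (-z * Real.cosh t) * Real.cosh (ν * t)

/-- The Matérn correlation kernel with smoothness `ν`, as a function of the distance `d ≥ 0`.
The value at `d = 0` is the continuous extension `1` of the formula. -/
def maternKernel (ν d : ℝ) : ℝ :=
  if d = 0 then 1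
  else (Real.Gamma ν)⁻¹ * (2 : ℝ) ^ (1 - ν) * (2 * Real.sqrt ν * d) ^ ν *
    besselK ν (2 * Real.sqrt ν * d)

/-- The Rational Quadratic correlation kernel with parameter `ν`. -/
def rationalQuadraticKernel (ν d : ℝ) : ℝ := (1 + d ^ 2) ^ (-ν)

/-- The Squared Exponential correlation kernel. -/
def squaredExponentialKernel (d : ℝ) : ℝ := Real.exp (-d ^ 2)

/-- The correlation matrix `Σ_θ`, with entries `K_θ(‖x i - x j‖) = K (‖x i - x j‖ / θ)`. -/
def corrMatrix {r n : ℕ} (K : ℝ → ℝ) (x : Fin n → EuclideanSpace ℝ (Fin r)) (θ : ℝ) :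
    Matrix (Fin n) (Fin n) ℝ :=
  Matrix.of fun i j => K (‖x i - x j‖ / θ)

/-- The entrywise derivative `d Σ_θ / d θ`. -/
def corrMatrixDeriv {r n : ℕ} (K : ℝ → ℝ) (x : Fin n → EuclideanSpace ℝ (Fin r)) (θ : ℝ) :
    Matrix (Fin n) (Fin n) ℝ :=
  Matrix.of fun i j => deriv (fun t : ℝ => corrMatrix K x t i j) θ

/-- The matrix `H` with entries `f j (x i)`. -/
def designMatrix {r n p : ℕ} (f : Fin p → EuclideanSpace ℝ (Fin r) → ℝ)
    (x : Fin n → EuclideanSpace ℝ (Fin r)) : Matrix (Fin n) (Fin p) ℝ :=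
  Matrix.of fun i j => f j (x i)

/-- `Q = I - H (Hᵀ Σ⁻¹ H)⁻¹ Hᵀ Σ⁻¹`. For `p = 0` this is the identity matrix. -/
def projQ {n p : ℕ} (S : Matrix (Fin n) (Fin n) ℝ) (H : Matrix (Fin n) (Fin p) ℝ) :
    Matrix (Fin n) (Fin n) ℝ :=
  1 - H * (Hᵀ * S⁻¹ * H)⁻¹ * Hᵀ * S⁻¹

/-- The quantity `Tr[(Σ_θ' Σ_θ⁻¹ Q_θ)²] - (Tr[Σ_θ' Σ_θ⁻¹ Q_θ])² / (n - p)`, whose square root is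
the unnormalised marginal reference prior at `θ`. -/
def refPriorRadicand {r n p : ℕ} (K : ℝ → ℝ) (x : Fin n → EuclideanSpace ℝ (Fin r))
    (H : Matrix (Fin n) (Fin p) ℝ) (θ : ℝ) : ℝ :=
  ((corrMatrixDeriv K x θ * (corrMatrix K x θ)⁻¹ * projQ (corrMatrix K x θ) H) ^ 2).trace -
    1 / ((n : ℝ) - (p : ℝ)) *
      (corrMatrixDeriv K x θ * (corrMatrix K x θ)⁻¹ * projQ (corrMatrix K x θ) H).trace ^ 2

/-- `π` is a version of the marginal reference prior on `(0, ∞)`, which is defined up to a positive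
multiplicative constant. -/
def IsMarginalReferencePrior {r n p : ℕ} (K : ℝ → ℝ) (x : Fin n → EuclideanSpace ℝ (Fin r))
    (H : Matrix (Fin n) (Fin p) ℝ) (π : ℝ → ℝ) : Prop :=
  ∃ c : ℝ, 0 < c ∧ ∀ θ : ℝ, 0 < θ → π θ = c * Real.sqrt (refPriorRadicand K x H θ)

/-- The formula for the reference prior is meaningful at every `θ > 0`: the matrix `Σ_θ` is positive
definite, its entries are differentiable in `θ`, and the radicand is nonnegative. -/
def ReferencePriorWellDefined {r n p : ℕ} (K : ℝ → ℝ) (x : Fin n → EuclideanSpace ℝ (Fin r))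
    (H : Matrix (Fin n) (Fin p) ℝ) : Prop :=
  ∀ θ : ℝ, 0 < θ →
    (corrMatrix K x θ).PosDef ∧
    (∀ i j, DifferentiableAt ℝ (fun t : ℝ => corrMatrix K x t i j) θ) ∧
    0 ≤ refPriorRadicand K x H θ

end

/-! All three kernels are mixtures of Gaussians `exp (-g d²)` over a random `g > 0`: a constant, a
Gamma variable, or the inverse of one. Everything rests on comparing quadratic forms: if `|cᵀΣ'c| ≤
a cᵀΣc` for all `c`, then the radicand lies in `[0, (n a)²]` (`trace_radicand_bounds`), because
`Σ⁻¹Q` compresses `Σ` to an orthogonal projection of trace `n - p`.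

For one Gaussian, the derivative in the log-scale is dominated by the kernel matrix uniformly over
all scales (`exists_abs_gaussDerivForm_le`). For large `s` the matrix is close to the identity. For
bounded `s`, `exp (-s‖y - z‖²)` is `exp (2s⟨y, z⟩)` up to a diagonal rescaling, a series of positive
semidefinite forms whose first `n` terms are jointly definite and therefore control all the others.
Integrating over the mixture gives `a = C / θ`, hence a prior `O(θ⁻¹)` at infinity for every
mixture, which implies all three claims there.

As `θ → 0⁺`, `Σ` tends to the identity, so the prior is bounded by the entries of `Σ'`. These are
`O(θ)` when `E[1/g]` is finite (Matérn, Squared Exponential); for the Rational Quadratic kernel they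
are estimated directly. -/

/-! ### Linear algebra of the radicand -/

theorem mulVec_injective_of_rank_eq {n p : ℕ} {H : Matrix (Fin n) (Fin p) ℝ} (hH : H.rank = p) :
    Function.Injective H.mulVec := by
  have h := LinearMap.finrank_range_add_finrank_ker H.mulVecLin
  have h1 : Module.finrank ℝ (LinearMap.range H.mulVecLin) = p := hH
  rw [h1, Module.finrank_fin_fun] at h
  have h2 : LinearMap.ker H.mulVecLin = ⊥ := Submodule.finrank_eq_zero.mp (by omega)
  exact LinearMap.ker_eq_bot.mp h2

/-- Polarisation: evaluate the form at `e_i + e_j` and `e_i - e_j` and subtract. The argument covers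
`i = j` as well. -/
theorem abs_entry_le_of_abs_form_le {n : ℕ} {M : Matrix (Fin n) (Fin n) ℝ} (hM : Mᵀ = M) {a : ℝ}
    (h : ∀ c : Fin n → ℝ, |c ⬝ᵥ M *ᵥ c| ≤ a * (c ⬝ᵥ c)) (i j : Fin n) : |M i j| ≤ a := by
  have hsymm : M j i = M i j := by conv_lhs => rw [← hM, Matrix.transpose_apply]
  have e (u : ℝ) : (Pi.single i (1 : ℝ) + u • Pi.single j (1 : ℝ)) ⬝ᵥ
      M *ᵥ (Pi.single i (1 : ℝ) + u • Pi.single j (1 : ℝ)) =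
      M i i + 2 * u * M i j + u ^ 2 * M j j := by
    simp [Matrix.mulVec_add, Matrix.mulVec_smul, add_dotProduct, dotProduct_add, hsymm]
    ring
  have e' (u : ℝ) : (Pi.single i (1 : ℝ) + u • Pi.single j (1 : ℝ) : Fin n → ℝ) ⬝ᵥ
      (Pi.single i (1 : ℝ) + u • Pi.single j (1 : ℝ)) =
      1 + 2 * u * (1 : Matrix (Fin n) (Fin n) ℝ) i j + u ^ 2 := by
    simp [dotProduct_add, Matrix.one_apply, Pi.single_apply]
    by_cases hij : i = j <;> simp [hij, eq_comm] <;> ring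
  have h1 := abs_le.mp (h (Pi.single i 1 + (1 : ℝ) • Pi.single j 1))
  have h2 := abs_le.mp (h (Pi.single i 1 + (-1 : ℝ) • Pi.single j 1))
  rw [e, e'] at h1 h2
  rw [abs_le]
  constructor <;> nlinarith

theorem trace_sq_eq_sum {n : ℕ} {M : Matrix (Fin n) (Fin n) ℝ} (hM : Mᵀ = M) :
    (M * M).trace = ∑ i, ∑ j, M i j ^ 2 := by
  simp only [Matrix.trace, Matrix.diag_apply, Matrix.mul_apply]
  refine Finset.sum_congr rfl fun i _ => Finset.sum_congr rfl fun j _ => ?_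
  have : M j i = M i j := by conv_lhs => rw [← hM, Matrix.transpose_apply]
  rw [this, sq]

/-- Cauchy–Schwarz for the Frobenius inner product. -/
theorem trace_mul_sq_le {n : ℕ} {M N : Matrix (Fin n) (Fin n) ℝ} (hM : Mᵀ = M) (hN : Nᵀ = N) :
    (M * N).trace ^ 2 ≤ (M * M).trace * (N * N).trace := by
  rw [trace_sq_eq_sum hM, trace_sq_eq_sum hN]
  have : (M * N).trace = ∑ q : Fin n × Fin n, M q.1 q.2 * N q.1 q.2 := by
    rw [Fintype.sum_prod_type]
    simp only [Matrix.trace, Matrix.diag_apply, Matrix.mul_apply]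
    refine Finset.sum_congr rfl fun i _ => Finset.sum_congr rfl fun j _ => ?_
    have : N j i = N i j := by conv_lhs => rw [← hN, Matrix.transpose_apply]
    rw [this]
  rw [this, ← Fintype.sum_prod_type (fun q : Fin n × Fin n => M q.1 q.2 ^ 2),
    ← Fintype.sum_prod_type (fun q : Fin n × Fin n => N q.1 q.2 ^ 2)]
  exact Finset.sum_mul_sq_le_sq_mul_sq _ _ _

open scoped MatrixOrder in
-- Write `S = FᵀF`. Then `N = F P Fᵀ` is an orthogonal projection of trace `m`, and `M = F P B P Fᵀ`
-- is symmetric with `M N = M` and with the same traces of `M` and `M²` as `B P` and `(B P)²`. The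
-- lower bound is Cauchy–Schwarz for `M` and `N`. For the upper bound, `|cᵀMc| ≤ a cᵀNc ≤ a cᵀc`
-- bounds each of the `n²` entries of `M` by `a`.
theorem trace_radicand_of_isCompression {n : ℕ} {S B P : Matrix (Fin n) (Fin n) ℝ} {m a : ℝ}
    (hm : 0 < m) (hS : S.PosSemidef) (hB : Bᵀ = B) (hP : Pᵀ = P) (hPSP : P * S * P = P)
    (htr : (S * P).trace = m)
    (hab : ∀ c : Fin n → ℝ, |c ⬝ᵥ B *ᵥ c| ≤ a * (c ⬝ᵥ S *ᵥ c)) (ha : 0 ≤ a) :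
    0 ≤ (B * P * (B * P)).trace - 1 / m * (B * P).trace ^ 2 ∧
      (B * P * (B * P)).trace - 1 / m * (B * P).trace ^ 2 ≤ (n * a) ^ 2 := by
  obtain ⟨F, hF⟩ : ∃ F : Matrix (Fin n) (Fin n) ℝ, S = Fᵀ * F := by
    obtain ⟨F, hF⟩ := CStarAlgebra.nonneg_iff_eq_star_mul_self.mp (Matrix.nonneg_iff_posSemidef.mpr hS)
    exact ⟨F, by simpa [Matrix.star_eq_conjTranspose] using hF⟩
  -- `P S P = P` in right-associated form with a trailing factor, so that it can serve as a rewrite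
  -- rule inside longer products.
  have hPP (X : Matrix (Fin n) (Fin n) ℝ) : P * (Fᵀ * (F * (P * X))) = P * X := by
    rw [← Matrix.mul_assoc Fᵀ, ← hF, ← Matrix.mul_assoc S, ← Matrix.mul_assoc, ← Matrix.mul_assoc,
      hPSP]
  have hPP' : P * (Fᵀ * (F * P)) = P := by simpa using hPP 1
  set N := F * P * Fᵀ with hNdef
  set M := F * P * B * P * Fᵀ with hMdef
  have hN : Nᵀ = N := by simp [hNdef, Matrix.transpose_mul, hP, Matrix.mul_assoc]
  have hM : Mᵀ = M := by simp [hMdef, Matrix.transpose_mul, hP, hB, Matrix.mul_assoc]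
  have hNN : N * N = N := by simp only [hNdef, Matrix.mul_assoc, hPP]
  have hMN : M * N = M := by simp only [hNdef, hMdef, Matrix.mul_assoc, hPP]
  have htN : N.trace = m := by
    rw [hNdef, Matrix.trace_mul_comm, ← Matrix.mul_assoc, ← hF, htr]
  have htM : M.trace = (B * P).trace := by
    rw [hMdef, Matrix.trace_mul_comm, Matrix.trace_mul_comm B]
    calc (Fᵀ * (F * P * B * P)).trace = (Fᵀ * (F * (P * B)) * P).trace := by
          simp only [Matrix.mul_assoc]
      _ = _ := by rw [Matrix.trace_mul_comm]; simp only [hPP]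
  have htMM : (M * M).trace = (B * P * (B * P)).trace := by
    have : M * M = F * P * B * P * B * P * Fᵀ := by
      simp only [hMdef, Matrix.mul_assoc, hPP]
    rw [this, Matrix.trace_mul_comm, Matrix.trace_mul_comm (B * P), Matrix.mul_assoc B,
      Matrix.trace_mul_comm B]
    calc (Fᵀ * (F * P * B * P * B * P)).trace = (Fᵀ * (F * (P * B * P * B)) * P).trace := by
          simp only [Matrix.mul_assoc]
      _ = _ := by
        rw [Matrix.trace_mul_comm]; simp only [Matrix.mul_assoc, hPP]
  have hcs := trace_mul_sq_le hM hN
  rw [hMN, hNN, htN, htM, htMM] at hcs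
  have hform (c : Fin n → ℝ) : |c ⬝ᵥ M *ᵥ c| ≤ a * (c ⬝ᵥ c) := by
    have key (X : Matrix (Fin n) (Fin n) ℝ) : c ⬝ᵥ (F * P * X * P * Fᵀ) *ᵥ c =
        ((P * Fᵀ) *ᵥ c) ⬝ᵥ X *ᵥ ((P * Fᵀ) *ᵥ c) := by
      have : F * P * X * P * Fᵀ = (P * Fᵀ)ᵀ * (X * (P * Fᵀ)) := by
        simp [Matrix.transpose_mul, hP, Matrix.mul_assoc]
      rw [this, ← Matrix.mulVec_mulVec, ← Matrix.mulVec_mulVec, Matrix.mulVec_transpose,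
        dotProduct_comm c, ← Matrix.dotProduct_mulVec, dotProduct_comm]
    have hN1 : c ⬝ᵥ N *ᵥ c = (N *ᵥ c) ⬝ᵥ (N *ᵥ c) := by
      conv_lhs => rw [← hNN]
      rw [← Matrix.mulVec_mulVec, Matrix.dotProduct_mulVec]
      conv_lhs => rw [← hN, Matrix.vecMul_transpose, hN]
    have hN2 : 0 ≤ (c - N *ᵥ c) ⬝ᵥ (c - N *ᵥ c) := by
      simpa using dotProduct_star_self_nonneg (c - N *ᵥ c)
    have hN3 : c ⬝ᵥ N *ᵥ c ≤ c ⬝ᵥ c := by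
      rw [sub_dotProduct, dotProduct_sub, dotProduct_sub, ← hN1, dotProduct_comm (N *ᵥ c) c] at hN2
      linarith
    have hSN : F * P * S * P * Fᵀ = N := by
      rw [hNdef, Matrix.mul_assoc F, Matrix.mul_assoc F, hPSP]
    have h1 := hab ((P * Fᵀ) *ᵥ c)
    rw [← key, ← key, hSN] at h1
    exact h1.trans (mul_le_mul_of_nonneg_left hN3 ha)
  have hent := abs_entry_le_of_abs_form_le hM hform
  have hub : (M * M).trace ≤ (n * a) ^ 2 := by
    rw [trace_sq_eq_sum hM]
    calc ∑ i, ∑ j, M i j ^ 2 ≤ ∑ _i : Fin n, ∑ _j : Fin n, a ^ 2 :=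
          Finset.sum_le_sum fun i _ => Finset.sum_le_sum fun j _ =>
            sq_le_sq' (neg_le_of_abs_le (hent i j)) (le_of_abs_le (hent i j))
      _ = (n * a) ^ 2 := by simp; ring
  rw [htMM] at hub
  constructor
  · rw [sub_nonneg, one_div, inv_mul_le_iff₀ hm]
    linarith
  · have : 0 ≤ 1 / m * (B * P).trace ^ 2 := by positivity
    linarith

/-- If the quadratic form of the symmetric matrix `B` is dominated by `a` times that of `S`, then
`Tr[(B S⁻¹ Q)²] - (Tr[B S⁻¹ Q])² / (n - p)` lies between `0` and `(n a)²`. -/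
theorem trace_radicand_bounds {n p : ℕ} (hpn : p < n) {S B : Matrix (Fin n) (Fin n) ℝ}
    {H : Matrix (Fin n) (Fin p) ℝ} (hH : H.rank = p) (hS : S.PosDef) (hB : Bᵀ = B) {a : ℝ}
    (ha : 0 ≤ a) (hab : ∀ c : Fin n → ℝ, |c ⬝ᵥ B *ᵥ c| ≤ a * (c ⬝ᵥ S *ᵥ c)) :
    0 ≤ ((B * S⁻¹ * projQ S H) ^ 2).trace -
        1 / ((n : ℝ) - (p : ℝ)) * (B * S⁻¹ * projQ S H).trace ^ 2 ∧
      ((B * S⁻¹ * projQ S H) ^ 2).trace -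
        1 / ((n : ℝ) - (p : ℝ)) * (B * S⁻¹ * projQ S H).trace ^ 2 ≤ (n * a) ^ 2 := by
  have hm : (0 : ℝ) < (n : ℝ) - p := by
    have : (p : ℝ) < n := by exact_mod_cast hpn
    linarith
  have hSt : Sᵀ = S := by simpa using hS.isHermitian.eq
  have hSit : (S⁻¹)ᵀ = S⁻¹ := by rw [Matrix.transpose_nonsing_inv, hSt]
  have hSu : IsUnit S.det := hS.det_pos.ne'.isUnit
  have hG : (Hᵀ * S⁻¹ * H).PosDef := by
    simpa using hS.inv.conjTranspose_mul_mul_same (mulVec_injective_of_rank_eq hH)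
  set G := Hᵀ * S⁻¹ * H with hGdef
  have hGu : IsUnit G.det := hG.det_pos.ne'.isUnit
  have hGt : (G⁻¹)ᵀ = G⁻¹ := by
    rw [Matrix.transpose_nonsing_inv]
    congr 1
    simpa using hG.isHermitian.eq
  have hQ : projQ S H = 1 - H * G⁻¹ * Hᵀ * S⁻¹ := rfl
  -- The compression lemma is applied with `P = S⁻¹Q`; then `S P = Q` is idempotent of trace `n -
  -- p`.
  have hSP : S * (S⁻¹ * projQ S H) = projQ S H := by
    rw [← Matrix.mul_assoc, Matrix.mul_nonsing_inv _ hSu, Matrix.one_mul]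
  have hQQ : projQ S H * projQ S H = projQ S H := by
    have : H * G⁻¹ * Hᵀ * S⁻¹ * (H * G⁻¹ * Hᵀ * S⁻¹) = H * G⁻¹ * Hᵀ * S⁻¹ := by
      calc H * G⁻¹ * Hᵀ * S⁻¹ * (H * G⁻¹ * Hᵀ * S⁻¹) = H * (G⁻¹ * G) * G⁻¹ * Hᵀ * S⁻¹ := by
            simp only [hGdef, Matrix.mul_assoc]
        _ = _ := by rw [Matrix.nonsing_inv_mul _ hGu, Matrix.mul_one]
    rw [hQ, Matrix.sub_mul, Matrix.mul_sub, Matrix.mul_sub, this]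
    simp
  have htr : (S * (S⁻¹ * projQ S H)).trace = (n : ℝ) - p := by
    rw [hSP, hQ, Matrix.trace_sub, Matrix.mul_assoc, Matrix.trace_mul_comm, ← Matrix.mul_assoc,
      ← hGdef, Matrix.mul_nonsing_inv _ hGu] 
    simp
  have hPt : (S⁻¹ * projQ S H)ᵀ = S⁻¹ * projQ S H := by
    simp only [hQ, Matrix.mul_sub, Matrix.transpose_sub, Matrix.transpose_mul, hSit, hGt,
      Matrix.transpose_transpose, Matrix.mul_one, Matrix.mul_assoc]
  have hPSP : S⁻¹ * projQ S H * S * (S⁻¹ * projQ S H) = S⁻¹ * projQ S H := by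
    rw [Matrix.mul_assoc _ S, hSP, Matrix.mul_assoc, hQQ]
  have := trace_radicand_of_isCompression hm hS.posSemidef hB hPt hPSP htr hab ha
  rw [sq (B * S⁻¹ * projQ S H)]
  simpa only [Matrix.mul_assoc] using this

/-- The quadratic form `∑ i j, c i * c j * M i j`. -/
def quadForm {ι : Type*} [Fintype ι] (M : ι → ι → ℝ) (c : ι → ℝ) : ℝ :=
  ∑ i, ∑ j, c i * c j * M i j

/-! ### Elementary bounds on quadratic forms -/

section quadForm
variable {ι : Type*} [Fintype ι]

theorem quadForm_eq_dotProduct_mulVec (M : Matrix ι ι ℝ) (c : ι → ℝ) :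
    quadForm M c = c ⬝ᵥ M *ᵥ c := by
  simp only [quadForm, dotProduct, Matrix.mulVec, Finset.mul_sum]
  exact Finset.sum_congr rfl fun i _ => Finset.sum_congr rfl fun j _ => by ring

theorem abs_quadForm_le {M : ι → ι → ℝ} {Y : ℝ} (hM : ∀ i j, |M i j| ≤ Y) (c : ι → ℝ) :
    |quadForm M c| ≤ Y * (Fintype.card ι * ∑ i, c i ^ 2) := by
  rcases isEmpty_or_nonempty ι with h | ⟨⟨i0⟩⟩
  · simp [quadForm]
  have hY : 0 ≤ Y := (abs_nonneg _).trans (hM i0 i0)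
  calc |quadForm M c| ≤ ∑ i, ∑ j, |c i| * |c j| * Y := by
        refine (Finset.abs_sum_le_sum_abs _ _).trans (Finset.sum_le_sum fun i _ =>
          (Finset.abs_sum_le_sum_abs _ _).trans (Finset.sum_le_sum fun j _ => ?_))
        rw [abs_mul, abs_mul]
        exact mul_le_mul_of_nonneg_left (hM i j) (by positivity)
    _ = Y * (∑ i, |c i|) ^ 2 := by
        rw [sq, Finset.sum_mul_sum, mul_comm, Finset.sum_mul]
        simp only [Finset.sum_mul]
    _ ≤ Y * (Fintype.card ι * ∑ i, c i ^ 2) := by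
        refine mul_le_mul_of_nonneg_left ?_ hY
        have := sq_sum_le_card_mul_sum_sq (s := Finset.univ) (f := fun i => |c i|)
        simpa using this

/-- The entries of `M - 1` are so small that its form is at most half of `∑ c i ^ 2`. -/
theorem half_sum_sq_le_quadForm [DecidableEq ι] {M : ι → ι → ℝ} (hd : ∀ i, M i i = 1)
    (ho : ∀ i j, i ≠ j → |M i j| ≤ 1 / (2 * Fintype.card ι)) (c : ι → ℝ) :
    1 / 2 * ∑ i, c i ^ 2 ≤ quadForm M c := by
  rcases isEmpty_or_nonempty ι with h | h
  · simp [quadForm]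
  have h1 := abs_quadForm_le (M := fun i j => M i j - if i = j then 1 else 0)
    (Y := 1 / (2 * Fintype.card ι)) (fun i j => by
      by_cases hij : i = j
      · subst hij
        simp [hd]
      · simpa [hij] using ho i j hij) c
  have h2 : quadForm (fun i j => M i j - if i = j then 1 else 0) c =
      quadForm M c - ∑ i, c i ^ 2 := by
    simp [quadForm, mul_sub, Finset.sum_sub_distrib, sq]
  have h3 : 1 / (2 * (Fintype.card ι : ℝ)) * (Fintype.card ι * ∑ i, c i ^ 2) =
      1 / 2 * ∑ i, c i ^ 2 := by
    have : (Fintype.card ι : ℝ) ≠ 0 := by exact_mod_cast Fintype.card_ne_zero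
    field_simp
  rw [h2, h3, abs_le] at h1
  linarith [h1.1]

/-- Compactness of the unit sphere. The norm on `ι → ℝ` is the sup norm, whence the division by the
cardinality. -/
theorem exists_pos_mul_sum_sq_le {F : (ι → ℝ) → ℝ} (hF : Continuous F)
    (hsmul : ∀ (t : ℝ) c, F (t • c) = t ^ 2 * F c) (hpos : ∀ c, c ≠ 0 → 0 < F c) :
    ∃ l : ℝ, 0 < l ∧ ∀ c, l * ∑ i, c i ^ 2 ≤ F c := by
  have h0 : F 0 = 0 := by simpa using hsmul 0 0
  rcases isEmpty_or_nonempty ι with h | h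
  · exact ⟨1, one_pos, fun c => by simp [Subsingleton.elim c 0, h0]⟩
  obtain ⟨m, hm, hmin⟩ := (isCompact_sphere (0 : ι → ℝ) 1).exists_isMinOn
    (NormedSpace.sphere_nonempty.mpr zero_le_one) hF.continuousOn
  have hm0 : m ≠ 0 := by
    rintro rfl
    simp at hm
  have hN : (0 : ℝ) < Fintype.card ι := by exact_mod_cast Fintype.card_pos
  refine ⟨F m / Fintype.card ι, div_pos (hpos m hm0) hN, fun c => ?_⟩
  by_cases hc : c = 0
  · simp [hc, h0]
  have hcn : 0 < ‖c‖ := norm_pos_iff.mpr hc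
  have h1 : F m ≤ F (‖c‖⁻¹ • c) := hmin (by simp [norm_smul, hcn.ne'])
  rw [hsmul, inv_pow, ← div_eq_inv_mul, le_div_iff₀ (by positivity)] at h1
  have h2 : ∑ i, c i ^ 2 ≤ Fintype.card ι * ‖c‖ ^ 2 := by
    calc ∑ i, c i ^ 2 ≤ ∑ _i : ι, ‖c‖ ^ 2 := Finset.sum_le_sum fun i _ => by
          rw [← sq_abs]
          exact pow_le_pow_left₀ (abs_nonneg _) (norm_le_pi_norm c i) 2
      _ = _ := by simp
  calc F m / Fintype.card ι * ∑ i, c i ^ 2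
      ≤ F m / Fintype.card ι * (Fintype.card ι * ‖c‖ ^ 2) :=
        mul_le_mul_of_nonneg_left h2 (div_pos (hpos m hm0) hN).le
    _ = F m * ‖c‖ ^ 2 := by field_simp
    _ ≤ F c := h1

end quadForm

/-! ### Power kernels and the exponential kernel -/

section powForm
variable {ι κ : Type*} [Fintype ι] [Fintype κ] (x : ι → κ → ℝ)

/-- The quadratic form of the kernel `⟨x i, x j⟩ ^ k`. -/
def powForm (k : ℕ) (c : ι → ℝ) : ℝ := quadForm (fun i j => (x i ⬝ᵥ x j) ^ k) c

theorem powForm_zero (c : ι → ℝ) : powForm x 0 c = (∑ i, c i) ^ 2 := by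
  simp [powForm, quadForm, sq, Finset.sum_mul_sum]

/-- Expanding one factor of the inner product gives the recursion behind the inductions below. In
effect `powForm x k c` is the squared norm of the tensor `∑ c i • x i ^ ⊗k`. -/
theorem powForm_succ (k : ℕ) (c : ι → ℝ) :
    powForm x (k + 1) c = ∑ a, powForm x k (fun i => c i * x i a) := by
  simp only [powForm, quadForm]
  rw [Finset.sum_comm (s := (Finset.univ : Finset κ))]
  refine Finset.sum_congr rfl fun i _ => ?_
  rw [Finset.sum_comm (s := (Finset.univ : Finset κ))]
  refine Finset.sum_congr rfl fun j _ => ?_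
  rw [pow_succ, dotProduct, Finset.mul_sum, Finset.mul_sum]
  exact Finset.sum_congr rfl fun a _ => by ring

theorem powForm_nonneg (k : ℕ) (c : ι → ℝ) : 0 ≤ powForm x k c := by
  induction k generalizing c with
  | zero => rw [powForm_zero]; positivity
  | succ k ih => rw [powForm_succ]; exact Finset.sum_nonneg fun a _ => ih _

theorem powForm_sum_le {τ : Type*} [Fintype τ] (k : ℕ) (v : τ → ι → ℝ) :
    powForm x k (fun i => ∑ a, v a i) ≤ Fintype.card τ * ∑ a, powForm x k (v a) := by
  induction k generalizing v with
  | zero =>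
    simp only [powForm_zero]
    rw [Finset.sum_comm]
    exact sq_sum_le_card_mul_sum_sq
  | succ k ih =>
    simp only [powForm_succ, Finset.sum_mul]
    rw [Finset.sum_comm, Finset.mul_sum]
    exact Finset.sum_le_sum fun b _ => ih fun a i => v a i * x i b

/-- Since `‖x i‖² = ∑ a, (x i a)²`, the left side involves only the diagonal pairs `(a, a)` among
the pairs `(a, b)` that make up the form of degree `k + 2`. -/
theorem powForm_normSq_mul_le (k : ℕ) (c : ι → ℝ) :
    powForm x k (fun i => (x i ⬝ᵥ x i) * c i) ≤ Fintype.card κ * powForm x (k + 2) c := by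
  have h : (fun i => (x i ⬝ᵥ x i) * c i) = fun i => ∑ a, c i * x i a * x i a := by
    ext i
    rw [dotProduct, Finset.sum_mul]
    exact Finset.sum_congr rfl fun a _ => by ring
  rw [h]
  refine (powForm_sum_le x k _).trans (mul_le_mul_of_nonneg_left ?_ (by positivity))
  rw [powForm_succ]
  refine Finset.sum_le_sum fun a _ => ?_
  rw [powForm_succ]
  exact Finset.single_le_sum (f := fun b => powForm x k (fun i => c i * x i a * x i b))
    (fun b _ => powForm_nonneg x k _) (Finset.mem_univ a)

/-- Cauchy–Schwarz for the pairing of `∑ c i • x i ^ ⊗k` with `u ^ ⊗k`. -/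
theorem sq_sum_mul_pow_le_powForm (u : κ → ℝ) (k : ℕ) (c : ι → ℝ) :
    (∑ i, c i * (u ⬝ᵥ x i) ^ k) ^ 2 ≤ (u ⬝ᵥ u) ^ k * powForm x k c := by
  induction k generalizing c with
  | zero => simp [powForm_zero]
  | succ k ih =>
    have h : ∑ i, c i * (u ⬝ᵥ x i) ^ (k + 1) =
        ∑ a, u a * ∑ i, (c i * x i a) * (u ⬝ᵥ x i) ^ k := by
      simp only [Finset.mul_sum]
      rw [Finset.sum_comm]
      refine Finset.sum_congr rfl fun i _ => ?_
      rw [pow_succ, dotProduct, Finset.mul_sum, Finset.mul_sum]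
      exact Finset.sum_congr rfl fun a _ => by ring
    have hu : u ⬝ᵥ u = ∑ a, u a ^ 2 := by simp [dotProduct, sq]
    have hu0 : 0 ≤ u ⬝ᵥ u := by rw [hu]; positivity
    rw [h, powForm_succ, pow_succ' (u ⬝ᵥ u), mul_assoc]
    refine (Finset.sum_mul_sq_le_sq_mul_sq _ _ _).trans ?_
    rw [← hu]
    refine mul_le_mul_of_nonneg_left ?_ hu0
    rw [Finset.mul_sum]
    exact Finset.sum_le_sum fun a _ => ih _

/-- Some linear functional is nonzero on each of the finitely many differences of distinct points.
-/
theorem exists_dotProduct_injective {x : ι → κ → ℝ} (hx : Function.Injective x) :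
    ∃ u : κ → ℝ, Function.Injective fun i => u ⬝ᵥ x i := by
  classical
  obtain ⟨φ, hφ⟩ := Module.exists_dual_forall_apply_ne_zero (K := ℝ)
    (fun q : {q : ι × ι // q.1 ≠ q.2} => x q.1.1 - x q.1.2)
    (fun q => sub_ne_zero.mpr (hx.ne q.2))
  refine ⟨fun a => φ (Pi.single a 1), fun i j hij => ?_⟩
  have key (y : κ → ℝ) : (fun a => φ (Pi.single a 1)) ⬝ᵥ y = φ y := by
    conv_rhs => rw [← Finset.univ_sum_single y, map_sum]
    refine Finset.sum_congr rfl fun a _ => ?_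
    have : (Pi.single a (y a) : κ → ℝ) = y a • Pi.single a 1 := by
      rw [← Pi.single_smul]; simp
    rw [this, map_smul, smul_eq_mul, mul_comm]
  by_contra hne
  refine hφ ⟨(i, j), hne⟩ ?_
  simp only [key] at hij
  rw [map_sub, hij, sub_self]

/-- Otherwise the moments `∑ c i (u ⬝ᵥ x i) ^ k`, `k < n`, all vanish along a direction `u`
separating the points, and Vandermonde forces `c = 0`. -/
theorem exists_powForm_pos {n : ℕ} {x : Fin n → κ → ℝ} (hx : Function.Injective x)
    {c : Fin n → ℝ} (hc : c ≠ 0) : ∃ k < n, 0 < powForm x k c := by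
  by_contra! h
  obtain ⟨u, hu⟩ := exists_dotProduct_injective hx
  refine hc (Matrix.eq_zero_of_forall_pow_sum_mul_pow_eq_zero hu fun k => ?_)
  have h1 := sq_sum_mul_pow_le_powForm x u k c
  have h2 : powForm x k c = 0 := le_antisymm (h k k.2) (powForm_nonneg x k c)
  rw [h2, mul_zero] at h1
  exact pow_eq_zero_iff two_ne_zero |>.mp (le_antisymm h1 (sq_nonneg _))

theorem exists_pos_mul_sum_sq_le_sum_powForm {n : ℕ} {x : Fin n → κ → ℝ}
    (hx : Function.Injective x) :
    ∃ l : ℝ, 0 < l ∧ ∀ c, l * ∑ i, c i ^ 2 ≤ ∑ k ∈ Finset.range n, powForm x k c := by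
  refine exists_pos_mul_sum_sq_le ?_ ?_ ?_
  · unfold powForm quadForm
    fun_prop
  · intro t c
    rw [Finset.mul_sum]
    refine Finset.sum_congr rfl fun k _ => ?_
    simp only [powForm, quadForm, Finset.mul_sum, Pi.smul_apply, smul_eq_mul]
    exact Finset.sum_congr rfl fun i _ => Finset.sum_congr rfl fun j _ => by ring
  · intro c hc
    obtain ⟨k, hk, hpos⟩ := exists_powForm_pos hx hc
    exact Finset.sum_pos' (fun k _ => powForm_nonneg x k c) ⟨k, Finset.mem_range.mpr hk, hpos⟩

theorem exists_powForm_le :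
    ∃ R : ℝ, 1 ≤ R ∧ ∀ k c, powForm x k c ≤ R ^ k * (Fintype.card ι * ∑ i, c i ^ 2) := by
  obtain ⟨R, hR⟩ := (Set.finite_range fun q : ι × ι => |x q.1 ⬝ᵥ x q.2|).bddAbove
  refine ⟨max 1 R, le_max_left _ _, fun k c => (le_abs_self _).trans
    (abs_quadForm_le (fun i j => ?_) c)⟩
  rw [abs_pow]
  exact pow_le_pow_left₀ (abs_nonneg _)
    ((hR ⟨(i, j), rfl⟩).trans (le_max_right _ _)) k

/-- The quadratic form of the kernel `t ^ m * exp t` with `t = 2 * s * ⟨x i, x j⟩`. -/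
noncomputable def expForm (m : ℕ) (s : ℝ) (c : ι → ℝ) : ℝ :=
  quadForm (fun i j => (2 * s * (x i ⬝ᵥ x j)) ^ m * Real.exp (2 * s * (x i ⬝ᵥ x j))) c

theorem hasSum_expForm (m : ℕ) (s : ℝ) (c : ι → ℝ) :
    HasSum (fun k : ℕ => (2 * s) ^ (k + m) / (k.factorial : ℝ) * powForm x (k + m) c)
      (expForm x m s c) := by
  have h (t : ℝ) : HasSum (fun k : ℕ => t ^ m * (t ^ k / (k.factorial : ℝ))) (t ^ m * Real.exp t) := by
    refine HasSum.mul_left _ ?_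
    rw [Real.exp_eq_exp_ℝ]
    exact NormedSpace.expSeries_div_hasSum_exp t
  have h2 := hasSum_sum (s := Finset.univ) fun i _ => hasSum_sum (s := Finset.univ) fun j _ =>
    (h (2 * s * (x i ⬝ᵥ x j))).mul_left (c i * c j)
  refine Eq.mp (congrArg (fun F => HasSum F (expForm x m s c)) (funext fun k => ?_)) h2
  simp only [powForm, quadForm, Finset.mul_sum]
  exact Finset.sum_congr rfl fun i _ => Finset.sum_congr rfl fun j _ => by
    rw [mul_pow _ _ m, mul_pow _ _ k, pow_add, pow_add]
    ring

theorem expForm_zero_nonneg {s : ℝ} (hs : 0 ≤ s) (c : ι → ℝ) : 0 ≤ expForm x 0 s c :=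
  (hasSum_expForm x 0 s c).nonneg fun k => mul_nonneg (by positivity) (powForm_nonneg x _ c)

theorem pow_mul_powForm_le_expForm_zero {s : ℝ} (hs : 0 ≤ s) (k : ℕ) (c : ι → ℝ) :
    (2 * s) ^ k * powForm x k c ≤ k.factorial * expForm x 0 s c := by
  have h := le_hasSum (hasSum_expForm x 0 s c) k fun j _ =>
    mul_nonneg (by positivity) (powForm_nonneg x _ c)
  have hk : (0 : ℝ) < k.factorial := by exact_mod_cast k.factorial_pos
  rw [add_zero, div_mul_eq_mul_div, div_le_iff₀ hk] at h
  linarith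

theorem expForm_zero_pos {n : ℕ} {x : Fin n → κ → ℝ} (hx : Function.Injective x) {s : ℝ}
    (hs : 0 < s) {c : Fin n → ℝ} (hc : c ≠ 0) : 0 < expForm x 0 s c := by
  obtain ⟨k, -, hk⟩ := exists_powForm_pos hx hc
  have h := pow_mul_powForm_le_expForm_zero x hs.le k c
  have h2 : 0 < (2 * s) ^ k * powForm x k c := by positivity
  exact pos_of_mul_pos_right (h2.trans_le h) (by positivity)

/-- For `k < n` the left side is, up to `k!`, a single term of the exponential series. For `k ≥ n`
it is at most geometric in `k` times `∑ c i ^ 2`, which the forms of degree `j < n` control; the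
surplus factor `(2s) ^ (k - j)` is bounded because `s ≤ S`. -/
theorem exists_pow_mul_powForm_le {n : ℕ} {x : Fin n → κ → ℝ} (hx : Function.Injective x)
    (S : ℝ) : ∃ A B : ℝ, 0 ≤ A ∧ 0 ≤ B ∧ ∀ s, 0 < s → s ≤ S → ∀ k c,
      (2 * s) ^ k * powForm x k c ≤ A * B ^ k * expForm x 0 s c := by
  obtain ⟨l, hl, hlow⟩ := exists_pos_mul_sum_sq_le_sum_powForm hx
  obtain ⟨R, hR, hup⟩ := exists_powForm_le x
  -- At least `1`, so that `b ^ (k - j) ≤ b ^ k`.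
  set b := max 1 (2 * S) with hb
  have hb1 : 1 ≤ b := le_max_left _ _
  have hRb : 1 ≤ R * b := one_le_mul_of_one_le_of_one_le hR hb1
  -- The summand `1` serves `k < n` and the summand `n * n / l` serves `k ≥ n`.
  refine ⟨n.factorial * (1 + n * n / l), R * b, by positivity, by positivity,
    fun s hs hsS k c => ?_⟩
  have hE := expForm_zero_nonneg x hs.le c
  have hsb : 2 * s ≤ b := le_max_of_le_right (by linarith)
  have hfac (j : ℕ) (hj : j < n) : (2 * s) ^ j * powForm x j c ≤ n.factorial * expForm x 0 s c :=
    (pow_mul_powForm_le_expForm_zero x hs.le j c).trans (mul_le_mul_of_nonneg_right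
      (by exact_mod_cast Nat.factorial_le hj.le) hE)
  have hRbk : 1 ≤ (R * b) ^ k := one_le_pow₀ hRb
  have hnl : 0 ≤ (n : ℝ) * n / l := by positivity
  rcases lt_or_ge k n with hk | hk
  · calc (2 * s) ^ k * powForm x k c ≤ n.factorial * expForm x 0 s c := hfac k hk
      _ = n.factorial * 1 * 1 * expForm x 0 s c := by ring
      _ ≤ n.factorial * (1 + n * n / l) * (R * b) ^ k * expForm x 0 s c := by
        gcongr
        linarith
  · have hj (j : ℕ) (hj : j < n) :
        (2 * s) ^ k * powForm x j c ≤ b ^ k * (n.factorial * expForm x 0 s c) := by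
      calc (2 * s) ^ k * powForm x j c
          = (2 * s) ^ (k - j) * ((2 * s) ^ j * powForm x j c) := by
            rw [← mul_assoc, ← pow_add, Nat.sub_add_cancel (hj.le.trans hk)]
        _ ≤ b ^ k * (n.factorial * expForm x 0 s c) := by
            refine mul_le_mul ?_ (hfac j hj)
              (mul_nonneg (by positivity) (powForm_nonneg x j c)) (by positivity)
            exact (pow_le_pow_left₀ (by positivity) hsb _).trans
              (pow_le_pow_right₀ hb1 (Nat.sub_le k j))
    have hsum : (2 * s) ^ k * (l * ∑ i, c i ^ 2) ≤
        n * (b ^ k * (n.factorial * expForm x 0 s c)) := by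
      calc (2 * s) ^ k * (l * ∑ i, c i ^ 2)
          ≤ (2 * s) ^ k * ∑ j ∈ Finset.range n, powForm x j c :=
            mul_le_mul_of_nonneg_left (hlow c) (by positivity)
        _ = ∑ j ∈ Finset.range n, (2 * s) ^ k * powForm x j c := Finset.mul_sum ..
        _ ≤ ∑ _j ∈ Finset.range n, b ^ k * (n.factorial * expForm x 0 s c) :=
            Finset.sum_le_sum fun j h => hj j (Finset.mem_range.mp h)
        _ = _ := by simp
    calc (2 * s) ^ k * powForm x k c
        ≤ (2 * s) ^ k * (R ^ k * (n * ∑ i, c i ^ 2)) := by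
          simpa using mul_le_mul_of_nonneg_left (hup k c) (by positivity : 0 ≤ (2 * s) ^ k)
      _ = R ^ k * n / l * ((2 * s) ^ k * (l * ∑ i, c i ^ 2)) := by field_simp
      _ ≤ R ^ k * n / l * (n * (b ^ k * (n.factorial * expForm x 0 s c))) :=
          mul_le_mul_of_nonneg_left hsum (by positivity)
      _ = n.factorial * (n * n / l) * (R * b) ^ k * expForm x 0 s c := by
          rw [mul_pow]; ring
      _ ≤ n.factorial * (1 + n * n / l) * (R * b) ^ k * expForm x 0 s c := by
          gcongr
          linarith

/-- The geometric bound on the degrees is summed against `1 / k!`. -/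
theorem exists_expForm_le {n : ℕ} {x : Fin n → κ → ℝ} (hx : Function.Injective x) (S : ℝ)
    (m : ℕ) : ∃ C : ℝ, 0 ≤ C ∧ ∀ s, 0 < s → s ≤ S → ∀ c,
      expForm x m s c ≤ C * expForm x 0 s c := by
  obtain ⟨A, B, hA, hB, h⟩ := exists_pow_mul_powForm_le hx S
  refine ⟨A * B ^ m * Real.exp B, by positivity, fun s hs hsS c => ?_⟩
  have h2 : HasSum (fun k : ℕ => A * B ^ m * expForm x 0 s c * (B ^ k / (k.factorial : ℝ)))
      (A * B ^ m * expForm x 0 s c * Real.exp B) := by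
    refine HasSum.mul_left _ ?_
    rw [Real.exp_eq_exp_ℝ]
    exact NormedSpace.expSeries_div_hasSum_exp B
  refine (hasSum_le (fun k => ?_) (hasSum_expForm x m s c) h2).trans_eq (by ring)
  have hk : (0 : ℝ) < k.factorial := by exact_mod_cast k.factorial_pos
  calc (2 * s) ^ (k + m) / (k.factorial : ℝ) * powForm x (k + m) c
      = (2 * s) ^ (k + m) * powForm x (k + m) c / k.factorial := by ring
    _ ≤ A * B ^ (k + m) * expForm x 0 s c / k.factorial :=
        div_le_div_of_nonneg_right (h s hs hsS _ c) hk.le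
    _ = _ := by rw [pow_add]; ring

theorem expForm_zero_normSq_mul_le {s : ℝ} (hs : 0 ≤ s) (c : ι → ℝ) :
    expForm x 0 s (fun i => 2 * s * (x i ⬝ᵥ x i) * c i) ≤
      Fintype.card κ * expForm x 2 s c := by
  refine hasSum_le (fun k => ?_) (hasSum_expForm x 0 s _) ((hasSum_expForm x 2 s c).mul_left _)
  have h : powForm x k (fun i => 2 * s * (x i ⬝ᵥ x i) * c i) =
      (2 * s) ^ 2 * powForm x k (fun i => (x i ⬝ᵥ x i) * c i) := by
    simp only [powForm, quadForm, Finset.mul_sum]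
    exact Finset.sum_congr rfl fun i _ => Finset.sum_congr rfl fun j _ => by ring
  rw [add_zero, h]
  calc (2 * s) ^ k / (k.factorial : ℝ) * ((2 * s) ^ 2 * powForm x k fun i => (x i ⬝ᵥ x i) * c i)
      ≤ (2 * s) ^ k / (k.factorial : ℝ) *
          ((2 * s) ^ 2 * (Fintype.card κ * powForm x (k + 2) c)) := by
        gcongr
        exact powForm_normSq_mul_le x k c
    _ = _ := by rw [pow_add]; ring

end powForm

/-! ### The Gaussian kernel, uniformly in its scale -/

section gaussForm
variable {κ : Type*} [Fintype κ] {n : ℕ} {x : Fin n → κ → ℝ}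

/-- The squared Euclidean distance between the points `x i` and `x j`. -/
def sqDist (x : Fin n → κ → ℝ) (i j : Fin n) : ℝ := (x i - x j) ⬝ᵥ (x i - x j)

theorem sqDist_nonneg (i j : Fin n) : 0 ≤ sqDist x i j := by
  simpa [sqDist] using dotProduct_star_self_nonneg (x i - x j)

theorem sqDist_self (i : Fin n) : sqDist x i i = 0 := by simp [sqDist]

theorem sqDist_pos (hx : Function.Injective x) {i j : Fin n} (h : i ≠ j) : 0 < sqDist x i j := by
  refine (sqDist_nonneg i j).lt_of_ne' fun h0 => h (hx ?_)
  exact sub_eq_zero.mp (dotProduct_self_eq_zero.mp h0)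

theorem sqDist_eq (i j : Fin n) :
    sqDist x i j = x i ⬝ᵥ x i + x j ⬝ᵥ x j - 2 * (x i ⬝ᵥ x j) := by
  rw [sqDist, sub_dotProduct, dotProduct_sub, dotProduct_sub, dotProduct_comm (x j) (x i)]
  ring

/-- The quadratic form of the Gaussian kernel `exp (-s ‖x i - x j‖²)`. -/
noncomputable def gaussForm (x : Fin n → κ → ℝ) (s : ℝ) (c : Fin n → ℝ) : ℝ :=
  quadForm (fun i j => Real.exp (-(s * sqDist x i j))) c

/-- The quadratic form of the kernel `s ‖x i - x j‖² exp (-s ‖x i - x j‖²)`. -/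
noncomputable def gaussDerivForm (x : Fin n → κ → ℝ) (s : ℝ) (c : Fin n → ℝ) : ℝ :=
  quadForm (fun i j => s * sqDist x i j * Real.exp (-(s * sqDist x i j))) c

theorem gaussForm_eq_expForm (s : ℝ) (c : Fin n → ℝ) :
    gaussForm x s c = expForm x 0 s (fun i => c i * Real.exp (-(s * (x i ⬝ᵥ x i)))) := by
  simp only [gaussForm, expForm, quadForm]
  refine Finset.sum_congr rfl fun i _ => Finset.sum_congr rfl fun j _ => ?_
  have : -(s * sqDist x i j) = -(s * (x i ⬝ᵥ x i)) + -(s * (x j ⬝ᵥ x j)) +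
      2 * s * (x i ⬝ᵥ x j) := by rw [sqDist_eq]; ring
  rw [this, Real.exp_add, Real.exp_add]
  ring

theorem gaussForm_pos (hx : Function.Injective x) {s : ℝ} (hs : 0 < s) {c : Fin n → ℝ}
    (hc : c ≠ 0) : 0 < gaussForm x s c := by
  rw [gaussForm_eq_expForm]
  refine expForm_zero_pos hx hs fun h => hc (funext fun i => ?_)
  simpa [Real.exp_ne_zero] using congrFun h i

theorem gaussForm_nonneg (hx : Function.Injective x) {s : ℝ} (hs : 0 < s) (c : Fin n → ℝ) :
    0 ≤ gaussForm x s c := by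
  by_cases hc : c = 0
  · simp [hc, gaussForm, quadForm]
  · exact (gaussForm_pos hx hs hc).le

/-- Expand `s‖x i - x j‖²`: the two squared norms contribute equally by symmetry, and the cross term
gives `expForm x 1`. -/
theorem gaussDerivForm_eq_expForm (s : ℝ) (c : Fin n → ℝ) {d : Fin n → ℝ}
    (hd : d = fun i => c i * Real.exp (-(s * (x i ⬝ᵥ x i)))) :
    gaussDerivForm x s c = ∑ i, ∑ j, (2 * s * (x i ⬝ᵥ x i) * d i) * d j *
      Real.exp (2 * s * (x i ⬝ᵥ x j)) - expForm x 1 s d := by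
  have hswap : ∑ i, ∑ j, s * (x j ⬝ᵥ x j) * d i * d j * Real.exp (2 * s * (x i ⬝ᵥ x j)) =
      ∑ i, ∑ j, s * (x i ⬝ᵥ x i) * d i * d j * Real.exp (2 * s * (x i ⬝ᵥ x j)) := by
    rw [Finset.sum_comm]
    refine Finset.sum_congr rfl fun i _ => Finset.sum_congr rfl fun j _ => ?_
    rw [dotProduct_comm (x j) (x i)]
    ring
  have h1 : gaussDerivForm x s c =
      ∑ i, ∑ j, s * (x i ⬝ᵥ x i) * d i * d j * Real.exp (2 * s * (x i ⬝ᵥ x j)) +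
      ∑ i, ∑ j, s * (x j ⬝ᵥ x j) * d i * d j * Real.exp (2 * s * (x i ⬝ᵥ x j)) -
      expForm x 1 s d := by
    simp only [gaussDerivForm, expForm, quadForm, ← Finset.sum_add_distrib,
      ← Finset.sum_sub_distrib]
    refine Finset.sum_congr rfl fun i _ => Finset.sum_congr rfl fun j _ => ?_
    have : -(s * sqDist x i j) = -(s * (x i ⬝ᵥ x i)) + -(s * (x j ⬝ᵥ x j)) +
        2 * s * (x i ⬝ᵥ x j) := by rw [sqDist_eq]; ring
    rw [this, Real.exp_add, Real.exp_add, sqDist_eq, hd]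
    ring
  rw [h1, hswap, ← Finset.sum_add_distrib]
  simp only [← Finset.sum_add_distrib]
  congr 1
  exact Finset.sum_congr rfl fun i _ => Finset.sum_congr rfl fun j _ => by ring

/-- The form is nonnegative at `a + b` and at `a - b`. -/
theorem two_mul_abs_expForm_polar_le {ι : Type*} [Fintype ι] (y : ι → κ → ℝ) {s : ℝ} (hs : 0 ≤ s)
    (a b : ι → ℝ) : 2 * |∑ i, ∑ j, a i * b j * Real.exp (2 * s * (y i ⬝ᵥ y j))| ≤
      expForm y 0 s a + expForm y 0 s b := by
  have hswap : ∑ i, ∑ j, b i * a j * Real.exp (2 * s * (y i ⬝ᵥ y j)) =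
      ∑ i, ∑ j, a i * b j * Real.exp (2 * s * (y i ⬝ᵥ y j)) := by
    rw [Finset.sum_comm]
    refine Finset.sum_congr rfl fun i _ => Finset.sum_congr rfl fun j _ => ?_
    rw [dotProduct_comm (y j) (y i)]
    ring
  have h (e : ℝ) : expForm y 0 s (fun i => a i + e * b i) = expForm y 0 s a +
      e * ∑ i, ∑ j, a i * b j * Real.exp (2 * s * (y i ⬝ᵥ y j)) +
      e * ∑ i, ∑ j, b i * a j * Real.exp (2 * s * (y i ⬝ᵥ y j)) +
      e ^ 2 * expForm y 0 s b := by
    simp only [expForm, quadForm, Finset.mul_sum, ← Finset.sum_add_distrib]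
    exact Finset.sum_congr rfl fun i _ => Finset.sum_congr rfl fun j _ => by ring
  have h1 := expForm_zero_nonneg y hs fun i => a i + 1 * b i
  have h2 := expForm_zero_nonneg y hs fun i => a i + (-1) * b i
  rw [h, hswap] at h1 h2
  rcases abs_cases (∑ i, ∑ j, a i * b j * Real.exp (2 * s * (y i ⬝ᵥ y j))) with h' | h' <;>
    linarith

/-- The mixed term is split by polarisation. Its part weighted by `2s‖x i‖²` is absorbed by `expForm
x 2`, which like `expForm x 1` is bounded by `expForm x 0`. -/
theorem exists_abs_gaussDerivForm_le_of_le (hx : Function.Injective x) (S : ℝ) :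
    ∃ C : ℝ, 0 ≤ C ∧ ∀ s, 0 < s → s ≤ S → ∀ c,
      |gaussDerivForm x s c| ≤ C * gaussForm x s c := by
  obtain ⟨C₁, hC₁, h₁⟩ := exists_expForm_le hx S 1
  obtain ⟨C₂, hC₂, h₂⟩ := exists_expForm_le hx S 2
  refine ⟨Fintype.card κ * C₂ + 1 + C₁, by positivity, fun s hs hsS c => ?_⟩
  rw [gaussForm_eq_expForm, gaussDerivForm_eq_expForm s c rfl]
  set d : Fin n → ℝ := fun i => c i * Real.exp (-(s * (x i ⬝ᵥ x i)))
  have h1 := two_mul_abs_expForm_polar_le x hs.le (fun i => 2 * s * (x i ⬝ᵥ x i) * d i) d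
  have h2 := expForm_zero_normSq_mul_le x hs.le d
  have h3 : Fintype.card κ * expForm x 2 s d ≤ Fintype.card κ * (C₂ * expForm x 0 s d) :=
    mul_le_mul_of_nonneg_left (h₂ s hs hsS d) (by positivity)
  have h4 : |expForm x 1 s d| ≤ C₁ * expForm x 0 s d := by
    rw [abs_of_nonneg]
    · exact h₁ s hs hsS d
    · exact (hasSum_expForm x 1 s d).nonneg fun k =>
        mul_nonneg (by positivity) (powForm_nonneg x _ d)
  refine (abs_sub _ _).trans ?_
  have h5 := abs_nonneg
    (∑ i, ∑ j, 2 * s * (x i ⬝ᵥ x i) * d i * d j * Real.exp (2 * s * (x i ⬝ᵥ x j)))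
  linarith

theorem abs_mul_exp_neg_le_one {t : ℝ} (ht : 0 ≤ t) : |t * Real.exp (-t)| ≤ 1 := by
  rw [abs_of_nonneg (by positivity), Real.exp_neg, ← div_eq_mul_inv,
    div_le_one (Real.exp_pos t)]
  linarith [Real.add_one_le_exp t]

/-- The logarithmic derivative of the Gaussian kernel matrix with respect to `log s` is bounded as
a form relative to the matrix itself, uniformly in the scale `s`. -/
theorem exists_abs_gaussDerivForm_le (hx : Function.Injective x) :
    ∃ C : ℝ, 0 ≤ C ∧ ∀ s, 0 < s → ∀ c, |gaussDerivForm x s c| ≤ C * gaussForm x s c := by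
  obtain ⟨δ, hδ, hδx⟩ : ∃ δ : ℝ, 0 < δ ∧ ∀ i j, i ≠ j → δ ≤ sqDist x i j := by
    have h : ∀ q ∈ (Finset.univ : Finset (Fin n × Fin n)), ∃ δ : ℝ, 0 < δ ∧
        (q.1 ≠ q.2 → δ ≤ sqDist x q.1 q.2) := fun q _ => by
      by_cases hq : q.1 = q.2
      · exact ⟨1, one_pos, fun h => absurd hq h⟩
      · exact ⟨_, sqDist_pos hx hq, fun _ => le_rfl⟩
    choose! δ hδ hδ' using h
    rcases isEmpty_or_nonempty (Fin n × Fin n) with hn | hn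
    · exact ⟨1, one_pos, fun i j => (hn.false (i, j)).elim⟩
    · obtain ⟨q, hq, hmin⟩ := Finset.exists_min_image Finset.univ δ Finset.univ_nonempty
      exact ⟨δ q, hδ q hq, fun i j hij => (hmin (i, j) (Finset.mem_univ _)).trans
        (hδ' (i, j) (Finset.mem_univ _) hij)⟩
  -- Beyond the threshold `2n / δ`, off-diagonal entries are at most `exp (-s δ) ≤ 1 / (2n)`, and
  -- diagonal dominance takes over.
  obtain ⟨C, hC, hle⟩ := exists_abs_gaussDerivForm_le_of_le hx (2 * n / δ)
  refine ⟨max C (2 * n), hC.trans (le_max_left _ _), fun s hs c => ?_⟩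
  have hG := gaussForm_nonneg hx hs c
  rcases le_or_gt s (2 * n / δ) with h | h
  · exact (hle s hs h c).trans (mul_le_mul_of_nonneg_right (le_max_left _ _) hG)
  · rw [div_lt_iff₀ hδ] at h
    have h1 : |gaussDerivForm x s c| ≤ 1 * (Fintype.card (Fin n) * ∑ i, c i ^ 2) :=
      abs_quadForm_le (fun i j => abs_mul_exp_neg_le_one
        (mul_nonneg hs.le (sqDist_nonneg i j))) c
    have h2 : 1 / 2 * ∑ i, c i ^ 2 ≤ gaussForm x s c := by
      refine half_sum_sq_le_quadForm (fun i => by simp [sqDist_self]) (fun i j hij => ?_) c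
      have hn : (0 : ℝ) < n := by exact_mod_cast i.pos
      rw [Real.abs_exp, Real.exp_neg, Fintype.card_fin, one_div]
      refine inv_anti₀ (by positivity) ?_
      have h3 : s * δ ≤ s * sqDist x i j := mul_le_mul_of_nonneg_left (hδx i j hij) hs.le
      linarith [Real.add_one_le_exp (s * sqDist x i j)]
    rw [Fintype.card_fin] at h1
    calc |gaussDerivForm x s c| ≤ 2 * n * (1 / 2 * ∑ i, c i ^ 2) := by linarith
      _ ≤ 2 * n * gaussForm x s c := mul_le_mul_of_nonneg_left h2 (by positivity)
      _ ≤ _ := mul_le_mul_of_nonneg_right (le_max_right _ _) hG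

end gaussForm

/-! ### Gaussian mixtures and the behaviour of their priors -/

open MeasureTheory

/-- `K` is the scale mixture `d ↦ ∫ exp (-g v d²) dμ(v)` of Gaussian kernels, where `μ` is a
probability measure and the inverse squared scale `g` is positive. -/
structure IsGaussianMixture (K : ℝ → ℝ) (μ : Measure ℝ) (g : ℝ → ℝ) : Prop where
  prob : IsProbabilityMeasure μ
  meas : Measurable g
  pos : ∀ᵐ v ∂μ, 0 < g v
  eq : ∀ d, 0 ≤ d → K d = ∫ v, Real.exp (-(g v * d ^ 2)) ∂μ

theorem EuclideanSpace.norm_sub_sq_eq_sqDist {r n : ℕ} (x : Fin n → EuclideanSpace ℝ (Fin r))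
    (i j : Fin n) : ‖x i - x j‖ ^ 2 = sqDist (fun i a => x i a) i j := by
  rw [EuclideanSpace.real_norm_sq_eq, sqDist, dotProduct]
  exact Finset.sum_congr rfl fun a _ => by simp [sq]

theorem EuclideanSpace.coord_injective {r n : ℕ} {x : Fin n → EuclideanSpace ℝ (Fin r)}
    (hx : Function.Injective x) : Function.Injective fun i a => x i a := fun i j h =>
  hx (by ext a; exact congrFun h a)

theorem corrMatrix_transpose {r n : ℕ} (K : ℝ → ℝ) (x : Fin n → EuclideanSpace ℝ (Fin r))
    (θ : ℝ) : (corrMatrix K x θ)ᵀ = corrMatrix K x θ := by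
  ext i j
  simp [corrMatrix, norm_sub_rev (x i)]

theorem corrMatrixDeriv_transpose {r n : ℕ} (K : ℝ → ℝ) (x : Fin n → EuclideanSpace ℝ (Fin r))
    (θ : ℝ) : (corrMatrixDeriv K x θ)ᵀ = corrMatrixDeriv K x θ := by
  ext i j
  simp [corrMatrixDeriv, corrMatrix, norm_sub_rev (x i)]

namespace IsGaussianMixture
variable {K : ℝ → ℝ} {μ : Measure ℝ} {g : ℝ → ℝ}

theorem apply_zero (h : IsGaussianMixture K μ g) : K 0 = 1 := by
  have := h.prob
  simp [h.eq 0 le_rfl]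

theorem integrable_exp (h : IsGaussianMixture K μ g) (d : ℝ) :
    Integrable (fun v => Real.exp (-(g v * d ^ 2))) μ := by
  have := h.prob
  have hg := h.meas
  refine Integrable.of_bound (by fun_prop) 1 ?_
  filter_upwards [h.pos] with v hv
  rw [Real.norm_eq_abs, Real.abs_exp, Real.exp_le_one_iff]
  have : 0 ≤ g v * d ^ 2 := by positivity
  linarith

theorem integrable_mul_exp (h : IsGaussianMixture K μ g) (d : ℝ) :
    Integrable (fun v => g v * d ^ 2 * Real.exp (-(g v * d ^ 2))) μ := by
  have := h.prob
  have hg := h.meas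
  refine Integrable.of_bound (by fun_prop) 1 ?_
  filter_upwards [h.pos] with v hv
  exact abs_mul_exp_neg_le_one (by positivity)

theorem hasDerivAt (h : IsGaussianMixture K μ g) {d θ : ℝ} (hd : 0 ≤ d) (hθ : 0 < θ) :
    HasDerivAt (fun t => K (d / t))
      (∫ v, 2 / θ * (g v * (d / θ) ^ 2 * Real.exp (-(g v * (d / θ) ^ 2))) ∂μ) θ := by
  have := h.prob
  have hg := h.meas
  -- On `t > θ / 2` the derivative is `2 / t` times a quantity `y exp (-y) ≤ 1`, hence at most `4 /
  -- θ`.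
  have key := (hasDerivAt_integral_of_dominated_loc_of_deriv_le (μ := μ) (x₀ := θ)
    (s := Set.Ioi (θ / 2)) (F := fun t v => Real.exp (-(g v * (d / t) ^ 2)))
    (F' := fun t v => 2 / t * (g v * (d / t) ^ 2 * Real.exp (-(g v * (d / t) ^ 2))))
    (bound := fun _ => 4 / θ) (Ioi_mem_nhds (by linarith))
    (Eventually.of_forall fun t => by fun_prop) (h.integrable_exp _) (by fun_prop) ?_
    (integrable_const _) ?_).2
  · refine key.congr_of_eventuallyEq ?_
    filter_upwards [Ioi_mem_nhds hθ] with t ht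
    exact h.eq _ (div_nonneg hd (le_of_lt ht))
  · filter_upwards [h.pos] with v hv t ht
    have ht : θ / 2 < t := ht
    have ht0 : 0 < t := by linarith
    rw [norm_mul, Real.norm_eq_abs, Real.norm_eq_abs, abs_of_pos (by positivity : 0 < 2 / t)]
    calc 2 / t * |g v * (d / t) ^ 2 * Real.exp (-(g v * (d / t) ^ 2))| ≤ 2 / t * 1 :=
          mul_le_mul_of_nonneg_left (abs_mul_exp_neg_le_one (by positivity)) (by positivity)
      _ ≤ 4 / θ := by
          rw [mul_one, div_le_div_iff₀ ht0 hθ]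
          linarith
  · refine Eventually.of_forall fun v t ht => ?_
    have ht : θ / 2 < t := ht
    have ht0 : t ≠ 0 := by linarith
    have h1 : HasDerivAt (fun t : ℝ => d / t) (-d / t ^ 2) t := by
      refine ((hasDerivAt_inv ht0).const_mul d).congr_deriv ?_
      ring
    have h2 : HasDerivAt (fun t : ℝ => -(g v * (d / t) ^ 2)) (2 / t * (g v * (d / t) ^ 2)) t := by
      refine ((h1.pow 2).const_mul (g v)).neg.congr_deriv ?_
      simp only [Nat.cast_ofNat, Nat.add_one_sub_one, pow_one]
      field_simp
    exact h2.exp.congr_deriv (by ring)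

variable {r n : ℕ} {x : Fin n → EuclideanSpace ℝ (Fin r)}

theorem differentiableAt_corrMatrix (h : IsGaussianMixture K μ g) {θ : ℝ} (hθ : 0 < θ)
    (i j : Fin n) : DifferentiableAt ℝ (fun t : ℝ => corrMatrix K x t i j) θ :=
  (h.hasDerivAt (norm_nonneg (x i - x j)) hθ).differentiableAt

theorem corrMatrixDeriv_apply (h : IsGaussianMixture K μ g) {θ : ℝ} (hθ : 0 < θ) (i j : Fin n) :
    corrMatrixDeriv K x θ i j = 2 / θ * ∫ v, g v * (‖x i - x j‖ / θ) ^ 2 *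
      Real.exp (-(g v * (‖x i - x j‖ / θ) ^ 2)) ∂μ := by
  rw [← integral_const_mul]
  exact (h.hasDerivAt (norm_nonneg (x i - x j)) hθ).deriv

theorem integral_quadForm {M : ℝ → Fin n → Fin n → ℝ} (hM : ∀ i j, Integrable (fun v => M v i j) μ)
    (c : Fin n → ℝ) : Integrable (fun v => quadForm (M v) c) μ ∧
      ∫ v, quadForm (M v) c ∂μ = quadForm (fun i j => ∫ v, M v i j ∂μ) c := by
  have h1 (i j : Fin n) : Integrable (fun v => c i * c j * M v i j) μ := (hM i j).const_mul _
  have h2 (i : Fin n) : Integrable (fun v => ∑ j, c i * c j * M v i j) μ :=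
    integrable_finsetSum _ fun j _ => h1 i j
  refine ⟨integrable_finsetSum _ fun i _ => h2 i, ?_⟩
  simp only [quadForm]
  rw [integral_finsetSum _ fun i _ => h2 i]
  refine Finset.sum_congr rfl fun i _ => ?_
  rw [integral_finsetSum _ fun j _ => h1 i j]
  exact Finset.sum_congr rfl fun j _ => integral_const_mul _ _

theorem scale_eq (x : Fin n → EuclideanSpace ℝ (Fin r)) (i j : Fin n) (u θ : ℝ) :
    u * (‖x i - x j‖ / θ) ^ 2 = u / θ ^ 2 * sqDist (fun i a => x i a) i j := by
  rw [div_pow, EuclideanSpace.norm_sub_sq_eq_sqDist]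
  ring

theorem quadForm_corrMatrix (h : IsGaussianMixture K μ g) {θ : ℝ} (hθ : 0 < θ) (c : Fin n → ℝ) :
    Integrable (fun v => gaussForm (fun i a => x i a) (g v / θ ^ 2) c) μ ∧
      quadForm (corrMatrix K x θ) c = ∫ v, gaussForm (fun i a => x i a) (g v / θ ^ 2) c ∂μ := by
  have hi (i j : Fin n) : Integrable
      (fun v => Real.exp (-(g v / θ ^ 2 * sqDist (fun i a => x i a) i j))) μ := by
    simpa only [scale_eq] using h.integrable_exp (‖x i - x j‖ / θ)
  obtain ⟨h1, h2⟩ := integral_quadForm hi c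
  refine ⟨h1, ?_⟩
  simp only [gaussForm, h2]
  refine congrArg (fun M => quadForm M c) (funext fun i => funext fun j => ?_)
  simp only [corrMatrix, Matrix.of_apply]
  rw [h.eq _ (div_nonneg (norm_nonneg _) hθ.le)]
  simp only [scale_eq]

theorem quadForm_corrMatrixDeriv (h : IsGaussianMixture K μ g) {θ : ℝ} (hθ : 0 < θ)
    (c : Fin n → ℝ) : Integrable (fun v => gaussDerivForm (fun i a => x i a) (g v / θ ^ 2) c) μ ∧
      quadForm (corrMatrixDeriv K x θ) c =
        2 / θ * ∫ v, gaussDerivForm (fun i a => x i a) (g v / θ ^ 2) c ∂μ := by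
  have hi (i j : Fin n) : Integrable (fun v => g v / θ ^ 2 * sqDist (fun i a => x i a) i j *
      Real.exp (-(g v / θ ^ 2 * sqDist (fun i a => x i a) i j))) μ := by
    simpa only [scale_eq] using h.integrable_mul_exp (‖x i - x j‖ / θ)
  obtain ⟨h1, h2⟩ := integral_quadForm hi c
  refine ⟨h1, ?_⟩
  simp only [gaussDerivForm, h2]
  simp only [quadForm, Finset.mul_sum]
  refine Finset.sum_congr rfl fun i _ => Finset.sum_congr rfl fun j _ => ?_
  rw [h.corrMatrixDeriv_apply hθ]
  simp only [scale_eq]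
  ring

theorem posDef_corrMatrix (h : IsGaussianMixture K μ g) (hx : Function.Injective x) {θ : ℝ}
    (hθ : 0 < θ) : (corrMatrix K x θ).PosDef := by
  have := h.prob
  refine Matrix.PosDef.of_dotProduct_mulVec_pos
    (by simpa [Matrix.IsHermitian] using corrMatrix_transpose K x θ) fun c hc => ?_
  obtain ⟨h1, h2⟩ := h.quadForm_corrMatrix (x := x) hθ c
  rw [star_trivial, ← quadForm_eq_dotProduct_mulVec, h2]
  have hpos : ∀ᵐ v ∂μ, 0 < gaussForm (fun i a => x i a) (g v / θ ^ 2) c := by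
    filter_upwards [h.pos] with v hv
    exact gaussForm_pos (EuclideanSpace.coord_injective hx) (by positivity) hc
  refine (integral_nonneg_of_ae (hpos.mono fun v hv => hv.le)).lt_of_ne' fun h0 => ?_
  rw [integral_eq_zero_iff_of_nonneg_ae (hpos.mono fun v hv => hv.le) h1] at h0
  obtain ⟨v, hv, hv'⟩ := (hpos.and h0).exists
  exact hv.ne' hv'

/-- The Gaussian bound has a constant independent of the scale, so it integrates over `μ`. The
factor `2 / θ` comes from differentiating `θ⁻²`. -/
theorem exists_abs_corrMatrixDeriv_form_le (h : IsGaussianMixture K μ g)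
    (hx : Function.Injective x) : ∃ C : ℝ, 0 ≤ C ∧ ∀ θ, 0 < θ → ∀ c : Fin n → ℝ,
      |c ⬝ᵥ corrMatrixDeriv K x θ *ᵥ c| ≤ C / θ * (c ⬝ᵥ corrMatrix K x θ *ᵥ c) := by
  obtain ⟨C, hC, hle⟩ := exists_abs_gaussDerivForm_le (EuclideanSpace.coord_injective hx)
  refine ⟨2 * C, by positivity, fun θ hθ c => ?_⟩
  obtain ⟨h1, h2⟩ := h.quadForm_corrMatrix (x := x) hθ c
  obtain ⟨h3, h4⟩ := h.quadForm_corrMatrixDeriv (x := x) hθ c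
  rw [← quadForm_eq_dotProduct_mulVec, ← quadForm_eq_dotProduct_mulVec, h2, h4, abs_mul,
    abs_of_pos (by positivity : 0 < 2 / θ)]
  have h5 : |∫ v, gaussDerivForm (fun i a => x i a) (g v / θ ^ 2) c ∂μ| ≤
      ∫ v, C * gaussForm (fun i a => x i a) (g v / θ ^ 2) c ∂μ := by
    refine abs_integral_le_integral_abs.trans (integral_mono_ae h3.abs (h1.const_mul C) ?_)
    filter_upwards [h.pos] with v hv
    exact hle _ (by positivity) c
  rw [integral_const_mul] at h5
  calc _ ≤ 2 / θ * (C * ∫ v, gaussForm (fun i a => x i a) (g v / θ ^ 2) c ∂μ) :=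
        mul_le_mul_of_nonneg_left h5 (by positivity)
    _ = _ := by ring

variable {p : ℕ} {H : Matrix (Fin n) (Fin p) ℝ}

theorem refPriorRadicand_bounds (h : IsGaussianMixture K μ g) (hpn : p < n)
    (hx : Function.Injective x) (hH : H.rank = p) {θ a : ℝ} (hθ : 0 < θ) (ha : 0 ≤ a)
    (hab : ∀ c : Fin n → ℝ, |c ⬝ᵥ corrMatrixDeriv K x θ *ᵥ c| ≤
      a * (c ⬝ᵥ corrMatrix K x θ *ᵥ c)) :
    0 ≤ refPriorRadicand K x H θ ∧ refPriorRadicand K x H θ ≤ (n * a) ^ 2 :=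
  trace_radicand_bounds hpn hH (h.posDef_corrMatrix hx hθ) (corrMatrixDeriv_transpose K x θ) ha hab

theorem referencePriorWellDefined (h : IsGaussianMixture K μ g) (hpn : p < n)
    (hx : Function.Injective x) (hH : H.rank = p) : ReferencePriorWellDefined K x H := by
  obtain ⟨C, hC, hle⟩ := h.exists_abs_corrMatrixDeriv_form_le hx
  intro θ hθ
  exact ⟨h.posDef_corrMatrix hx hθ, h.differentiableAt_corrMatrix hθ,
    (h.refPriorRadicand_bounds hpn hx hH hθ (by positivity) (hle θ hθ)).1⟩

theorem prior_isBigO_atTop (h : IsGaussianMixture K μ g) (hpn : p < n)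
    (hx : Function.Injective x) (hH : H.rank = p) {π : ℝ → ℝ}
    (hπ : IsMarginalReferencePrior K x H π) : π =O[atTop] fun θ : ℝ => θ⁻¹ := by
  obtain ⟨C, hC, hle⟩ := h.exists_abs_corrMatrixDeriv_form_le hx
  obtain ⟨k, hk, hπ⟩ := hπ
  refine IsBigO.of_bound (k * (n * C)) ?_
  filter_upwards [eventually_gt_atTop 0] with θ hθ
  have h1 := (h.refPriorRadicand_bounds hpn hx hH hθ (by positivity) (hle θ hθ)).2
  rw [hπ θ hθ, norm_mul, Real.norm_eq_abs, Real.norm_eq_abs, Real.norm_eq_abs, abs_of_pos hk,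
    abs_of_nonneg (Real.sqrt_nonneg _), abs_of_pos (inv_pos.mpr hθ)]
  calc k * √(refPriorRadicand K x H θ) ≤ k * (n * (C / θ)) :=
        mul_le_mul_of_nonneg_left (Real.sqrt_le_iff.mpr ⟨by positivity, h1⟩) hk.le
    _ = _ := by ring

theorem tendsto_atTop (h : IsGaussianMixture K μ g) : Tendsto K atTop (𝓝 0) := by
  have := h.prob
  have hg := h.meas
  have key : Tendsto (fun d => ∫ v, Real.exp (-(g v * d ^ 2)) ∂μ) atTop (𝓝 (∫ _v, (0 : ℝ) ∂μ)) := by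
    refine tendsto_integral_filter_of_dominated_convergence (fun _ => 1)
      (Eventually.of_forall fun d => by fun_prop) (Eventually.of_forall fun d => ?_)
      (integrable_const _) ?_
    · filter_upwards [h.pos] with v hv
      rw [Real.norm_eq_abs, Real.abs_exp, Real.exp_le_one_iff]
      have : 0 ≤ g v * d ^ 2 := by positivity
      linarith
    · filter_upwards [h.pos] with v hv
      exact Real.tendsto_exp_neg_atTop_nhds_zero.comp
        ((tendsto_pow_atTop two_ne_zero).const_mul_atTop hv)
  rw [integral_zero] at key
  refine key.congr' ?_
  filter_upwards [eventually_ge_atTop 0] with d hd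
  exact (h.eq d hd).symm

theorem eventually_half_le_corrMatrix (h : IsGaussianMixture K μ g) (hx : Function.Injective x) :
    ∀ᶠ θ in 𝓝[>] (0 : ℝ), ∀ c : Fin n → ℝ,
      1 / 2 * ∑ i, c i ^ 2 ≤ c ⬝ᵥ corrMatrix K x θ *ᵥ c := by
  have h1 : ∀ i j : Fin n, i ≠ j →
      ∀ᶠ θ in 𝓝[>] (0 : ℝ), |corrMatrix K x θ i j| ≤ 1 / (2 * Fintype.card (Fin n)) := by
    intro i j hij
    have hd : 0 < ‖x i - x j‖ := norm_pos_iff.mpr (sub_ne_zero.mpr (hx.ne hij))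
    have ht : Tendsto (fun θ => K (‖x i - x j‖ / θ)) (𝓝[>] 0) (𝓝 0) := by
      refine h.tendsto_atTop.comp ?_
      exact (tendsto_inv_nhdsGT_zero.const_mul_atTop hd).congr fun θ => (div_eq_mul_inv _ _).symm
    have hn : (0 : ℝ) < n := by exact_mod_cast i.pos
    have hε : (0 : ℝ) < 1 / (2 * Fintype.card (Fin n)) := by
      rw [Fintype.card_fin]
      positivity
    filter_upwards [ht.abs.eventually (gt_mem_nhds (abs_zero.trans_lt hε))] with θ hθ
    exact hθ.le
  have h2 : ∀ᶠ θ in 𝓝[>] (0 : ℝ), ∀ i j : Fin n, i ≠ j →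
      |corrMatrix K x θ i j| ≤ 1 / (2 * Fintype.card (Fin n)) := by
    simp only [eventually_all]
    exact h1
  filter_upwards [h2] with θ hθ c
  rw [← quadForm_eq_dotProduct_mulVec]
  exact half_sum_sq_le_quadForm (fun i => by simp [corrMatrix, h.apply_zero]) hθ c

/-- Near the origin `cᵀΣc ≥ (1/2) cᵀc`, so an entrywise bound on `Σ'` is already a bound relative to
`Σ`. -/
theorem prior_isBigO_nhdsGT_zero (h : IsGaussianMixture K μ g) (hpn : p < n)
    (hx : Function.Injective x) (hH : H.rank = p) {π b : ℝ → ℝ}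
    (hπ : IsMarginalReferencePrior K x H π) (hb0 : ∀ θ, 0 < θ → 0 ≤ b θ)
    (hb : ∀ i j, ∃ B : ℝ, ∀ θ, 0 < θ → |corrMatrixDeriv K x θ i j| ≤ B * b θ) :
    π =O[𝓝[>] (0 : ℝ)] b := by
  obtain ⟨k, hk, hπ⟩ := hπ
  choose B hB using hb
  obtain ⟨D, hD⟩ := (Set.finite_range fun q : Fin n × Fin n => B q.1 q.2).bddAbove
  set A := max 0 D
  have hA : 0 ≤ A := le_max_left _ _
  refine IsBigO.of_bound (k * (n * (2 * n * A))) ?_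
  filter_upwards [h.eventually_half_le_corrMatrix hx, self_mem_nhdsWithin] with θ hS hθ
  have hθ : 0 < θ := hθ
  have hbθ := hb0 θ hθ
  have hent (i j : Fin n) : |corrMatrixDeriv K x θ i j| ≤ A * b θ :=
    (hB i j θ hθ).trans (mul_le_mul_of_nonneg_right
      ((hD ⟨(i, j), rfl⟩).trans (le_max_right _ _)) hbθ)
  have hab (c : Fin n → ℝ) : |c ⬝ᵥ corrMatrixDeriv K x θ *ᵥ c| ≤
      2 * n * A * b θ * (c ⬝ᵥ corrMatrix K x θ *ᵥ c) := by
    rw [← quadForm_eq_dotProduct_mulVec]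
    calc _ ≤ A * b θ * (Fintype.card (Fin n) * ∑ i, c i ^ 2) := abs_quadForm_le hent c
      _ = 2 * n * A * b θ * (1 / 2 * ∑ i, c i ^ 2) := by rw [Fintype.card_fin]; ring
      _ ≤ _ := mul_le_mul_of_nonneg_left (hS c) (by positivity)
  have h1 := (h.refPriorRadicand_bounds hpn hx hH hθ (by positivity) hab).2
  rw [hπ θ hθ, norm_mul, Real.norm_eq_abs, Real.norm_eq_abs, Real.norm_eq_abs, abs_of_pos hk,
    abs_of_nonneg (Real.sqrt_nonneg _), abs_of_nonneg hbθ]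
  calc k * √(refPriorRadicand K x H θ) ≤ k * (n * (2 * n * A * b θ)) :=
        mul_le_mul_of_nonneg_left (Real.sqrt_le_iff.mpr ⟨by positivity, h1⟩) hk.le
    _ = _ := by ring

/-- If the mean squared scale `E[1 / g]` is finite, the prior vanishes at the origin. -/
theorem prior_isLittleO_nhdsGT_zero (h : IsGaussianMixture K μ g)
    (hg : Integrable (fun v => (g v)⁻¹) μ) (hpn : p < n) (hx : Function.Injective x)
    (hH : H.rank = p) {π : ℝ → ℝ} (hπ : IsMarginalReferencePrior K x H π) :
    π =o[𝓝[>] (0 : ℝ)] fun _ => (1 : ℝ) := by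
  have hO : π =O[𝓝[>] (0 : ℝ)] fun θ => θ := by
    refine h.prior_isBigO_nhdsGT_zero hpn hx hH hπ (fun θ hθ => hθ.le) fun i j => ?_
    by_cases hij : i = j
    · subst hij
      exact ⟨0, fun θ hθ => by simp [h.corrMatrixDeriv_apply hθ]⟩
    have hd : 0 < ‖x i - x j‖ := norm_pos_iff.mpr (sub_ne_zero.mpr (hx.ne hij))
    refine ⟨4 / ‖x i - x j‖ ^ 2 * ∫ v, (g v)⁻¹ ∂μ, fun θ hθ => ?_⟩
    rw [h.corrMatrixDeriv_apply hθ, abs_mul, abs_of_pos (by positivity : 0 < 2 / θ)]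
    -- From `exp t ≥ t² / 2` one gets `t exp (-t) ≤ 2 / t`; integrating costs `E[1/g]` and gains
    -- `θ²`, one power of which the prefactor `2 / θ` removes.
    have h1 : |∫ v, g v * (‖x i - x j‖ / θ) ^ 2 * Real.exp (-(g v * (‖x i - x j‖ / θ) ^ 2)) ∂μ| ≤
        ∫ v, 2 * (θ / ‖x i - x j‖) ^ 2 * (g v)⁻¹ ∂μ := by
      refine abs_integral_le_integral_abs.trans
        (integral_mono_ae (h.integrable_mul_exp _).abs (hg.const_mul _) ?_)
      filter_upwards [h.pos] with v hv
      have ht : 0 < g v * (‖x i - x j‖ / θ) ^ 2 := by positivity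
      have e : 2 * (θ / ‖x i - x j‖) ^ 2 * (g v)⁻¹ = 2 / (g v * (‖x i - x j‖ / θ) ^ 2) := by
        field_simp
      rw [abs_of_nonneg (by positivity), e]
      generalize g v * (‖x i - x j‖ / θ) ^ 2 = t at ht ⊢
      rw [Real.exp_neg, ← div_eq_mul_inv, div_le_div_iff₀ (Real.exp_pos t) ht]
      nlinarith [Real.quadratic_le_exp_of_nonneg ht.le]
    rw [integral_const_mul] at h1
    calc _ ≤ 2 / θ * (2 * (θ / ‖x i - x j‖) ^ 2 * ∫ v, (g v)⁻¹ ∂μ) :=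
          mul_le_mul_of_nonneg_left h1 (by positivity)
      _ = _ := by field_simp; ring
  refine hO.trans_isLittleO ((isLittleO_one_iff ℝ).mpr ?_)
  exact tendsto_nhdsWithin_of_tendsto_nhds tendsto_id

end IsGaussianMixture

/-! ### The three kernels as Gaussian mixtures -/

open ProbabilityTheory

theorem measurable_gammaPDF (a r : ℝ) : Measurable (gammaPDF a r) :=
  (measurable_gammaPDFReal a r).ennreal_ofReal

theorem integral_gammaMeasure_one {ν : ℝ} (hν : 0 < ν) (F : ℝ → ℝ) :
    ∫ v, F v ∂gammaMeasure ν 1 =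
      (Real.Gamma ν)⁻¹ * ∫ v in Set.Ioi (0 : ℝ), v ^ (ν - 1) * Real.exp (-v) * F v := by
  rw [gammaMeasure, integral_withDensity_eq_integral_toReal_smul
    (measurable_gammaPDF ν 1) (Eventually.of_forall fun v => by simp [gammaPDF]),
    ← integral_Ici_eq_integral_Ioi, ← integral_indicator measurableSet_Ici, ← integral_const_mul]
  refine integral_congr_ae (Eventually.of_forall fun v => ?_)
  simp only [gammaPDF]
  rw [ENNReal.toReal_ofReal (gammaPDFReal_nonneg hν one_pos v)]
  simp only [gammaPDFReal, Set.indicator_apply, Set.mem_Ici, smul_eq_mul]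
  split_ifs
  · simp only [Real.one_rpow, one_mul]
    ring
  · simp

theorem ae_pos_gammaMeasure (ν : ℝ) : ∀ᵐ v ∂gammaMeasure ν 1, 0 < v := by
  rw [gammaMeasure, ae_withDensity_iff (measurable_gammaPDF ν 1)]
  have h0 : ∀ᵐ v : ℝ ∂volume, v ≠ 0 := Measure.ae_ne volume 0
  filter_upwards [h0] with v hv hpdf
  by_contra! hle
  exact hpdf (gammaPDF_of_neg (hle.lt_of_ne hv))

/-- The scale is constant, so the location of the point mass is immaterial. -/
theorem isGaussianMixture_squaredExponentialKernel :
    IsGaussianMixture squaredExponentialKernel (Measure.dirac 0) fun _ => 1 where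
  prob := inferInstance
  meas := measurable_const
  pos := Eventually.of_forall fun _ => one_pos
  eq d _ := by simp [squaredExponentialKernel]

/-- The Laplace transform of the Gamma law at `d²`. -/
theorem isGaussianMixture_rationalQuadraticKernel {ν : ℝ} (hν : 0 < ν) :
    IsGaussianMixture (rationalQuadraticKernel ν) (gammaMeasure ν 1) fun v => v where
  prob := isProbabilityMeasure_gammaMeasure hν one_pos
  meas := measurable_id
  pos := ae_pos_gammaMeasure ν
  eq d _ := by
    have hd : 0 < 1 + d ^ 2 := by positivity
    have h : ∫ v in Set.Ioi (0 : ℝ), v ^ (ν - 1) * Real.exp (-v) * Real.exp (-(v * d ^ 2)) =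
        (1 / (1 + d ^ 2)) ^ ν * Real.Gamma ν := by
      rw [← Real.integral_rpow_mul_exp_neg_mul_Ioi hν hd]
      refine setIntegral_congr_fun measurableSet_Ioi fun v _ => ?_
      rw [mul_assoc, ← Real.exp_add]
      congr 2
      ring
    rw [integral_gammaMeasure_one hν, h, rationalQuadraticKernel, one_div, Real.inv_rpow hd.le,
      Real.rpow_neg hd.le]
    field_simp [(Real.Gamma_pos_of_pos hν).ne']

theorem integrableOn_rpow_mul_exp_neg_add_div {ν : ℝ} (hν : 0 < ν) {a : ℝ} (ha : 0 ≤ a) :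
    IntegrableOn (fun u : ℝ => u ^ (ν - 1) * Real.exp (-u) * Real.exp (-(a / u))) (Set.Ioi 0) := by
  have h := Real.GammaIntegral_convergent hν
  refine Integrable.mono' h ?_ ?_
  · exact Measurable.aestronglyMeasurable (by fun_prop)
  · filter_upwards [ae_restrict_mem measurableSet_Ioi] with u hu
    have hu : 0 < u := hu
    rw [Real.norm_eq_abs, abs_of_nonneg (by positivity), mul_comm (Real.exp (-u))]
    refine mul_le_of_le_one_right (by positivity) (Real.exp_le_one_iff.mpr ?_)
    have : 0 ≤ a / u := by positivity
    linarith

theorem image_mul_exp_univ {a : ℝ} (ha : 0 < a) :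
    (fun t : ℝ => a * Real.exp t) '' Set.univ = Set.Ioi 0 := by
  ext u
  simp only [Set.image_univ, Set.mem_range, Set.mem_Ioi]
  constructor
  · rintro ⟨t, rfl⟩
    positivity
  · intro hu
    exact ⟨Real.log (u / a), by rw [Real.exp_log (by positivity)]; field_simp⟩

/-- Averaging the integrand over `t` and `-t` turns `exp (ν t)` into `cosh (ν t)`. -/
theorem integral_exp_neg_mul_cosh_mul_exp {ν z : ℝ}
    (hint : Integrable fun t : ℝ => Real.exp (-z * Real.cosh t) * Real.exp (ν * t)) :
    ∫ t : ℝ, Real.exp (-z * Real.cosh t) * Real.exp (ν * t) = 2 * besselK ν z := by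
  have h1 := integral_comp_abs (f := fun t => Real.exp (-z * Real.cosh t) * Real.cosh (ν * t))
  have h2 (t : ℝ) : Real.exp (-z * Real.cosh |t|) * Real.cosh (ν * |t|) =
      1 / 2 * (Real.exp (-z * Real.cosh t) * Real.exp (ν * t) +
        Real.exp (-z * Real.cosh (-t)) * Real.exp (ν * -t)) := by
    have : Real.cosh (ν * |t|) = Real.cosh (ν * t) := by
      rcases abs_choice t with h | h <;> rw [h]
      rw [mul_neg, Real.cosh_neg]
    rw [this, Real.cosh_abs, Real.cosh_neg, Real.cosh_eq (ν * t), mul_neg]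
    ring
  have h3 : ∫ t : ℝ, Real.exp (-z * Real.cosh (-t)) * Real.exp (ν * -t) =
      ∫ t : ℝ, Real.exp (-z * Real.cosh t) * Real.exp (ν * t) :=
    integral_neg_eq_self (fun t : ℝ => Real.exp (-z * Real.cosh t) * Real.exp (ν * t)) volume
  rw [besselK, ← h1]
  simp only [h2]
  rw [integral_const_mul, integral_add hint hint.comp_neg, h3]
  ring

/-- The representation of `𝒦_ν` as an integral against the Gamma density. -/
theorem rpow_mul_besselK_eq_integral {ν z : ℝ} (hν : 0 < ν) (hz : 0 < z) :
    (2 : ℝ) ^ (1 - ν) * z ^ ν * besselK ν z =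
      ∫ u in Set.Ioi (0 : ℝ), u ^ (ν - 1) * Real.exp (-u) * Real.exp (-(z ^ 2 / 4 / u)) := by
  -- The substitution is `u = (z / 2) exp t`, which turns `u + z² / (4u)` into `z cosh t`.
  have hz2 : 0 < z / 2 := by positivity
  have hderiv : ∀ t ∈ (Set.univ : Set ℝ), HasDerivWithinAt (fun t : ℝ => z / 2 * Real.exp t)
      (z / 2 * Real.exp t) Set.univ t := fun t _ =>
    ((Real.hasDerivAt_exp t).const_mul _).hasDerivWithinAt
  have hinj : Set.InjOn (fun t : ℝ => z / 2 * Real.exp t) Set.univ := fun s _ t _ hst =>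
    Real.exp_injective (mul_left_cancel₀ hz2.ne' hst)
  have hpt (t : ℝ) : |z / 2 * Real.exp t| • ((z / 2 * Real.exp t) ^ (ν - 1) *
      Real.exp (-(z / 2 * Real.exp t)) * Real.exp (-(z ^ 2 / 4 / (z / 2 * Real.exp t)))) =
      (z / 2) ^ ν * (Real.exp (-z * Real.cosh t) * Real.exp (ν * t)) := by
    have hp : 0 < z / 2 * Real.exp t := by positivity
    have e1 : z ^ 2 / 4 / (z / 2 * Real.exp t) = z / 2 * Real.exp (-t) := by
      rw [Real.exp_neg]
      field_simp
      norm_num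
    have e2 : -(z / 2 * Real.exp t) + -(z / 2 * Real.exp (-t)) = -z * Real.cosh t := by
      rw [Real.cosh_eq]
      ring
    have e3 : (z / 2 * Real.exp t) * (z / 2 * Real.exp t) ^ (ν - 1) =
        (z / 2) ^ ν * Real.exp (ν * t) := by
      rw [Real.rpow_sub_one hp.ne', mul_div_cancel₀ _ hp.ne', Real.mul_rpow hz2.le (Real.exp_pos t).le,
        ← Real.exp_mul, mul_comm t]
    rw [abs_of_pos hp, smul_eq_mul, mul_assoc ((z / 2 * Real.exp t) ^ (ν - 1)), ← Real.exp_add, e1,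
      e2, ← mul_assoc, e3]
    ring
  have hF := integrableOn_rpow_mul_exp_neg_add_div hν (by positivity : 0 ≤ z ^ 2 / 4)
  rw [← image_mul_exp_univ hz2,
    integrableOn_image_iff_integrableOn_abs_deriv_smul MeasurableSet.univ hderiv hinj,
    integrableOn_univ] at hF
  simp only [hpt] at hF
  have hint : Integrable fun t : ℝ => Real.exp (-z * Real.cosh t) * Real.exp (ν * t) := by
    have hne : (z / 2) ^ ν ≠ 0 := (Real.rpow_pos_of_pos hz2 ν).ne'
    exact (integrable_const_mul_iff hne.isUnit _).mp hF
  rw [← image_mul_exp_univ hz2,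
    integral_image_eq_integral_abs_deriv_smul MeasurableSet.univ hderiv hinj, Measure.restrict_univ]
  simp only [hpt]
  rw [integral_const_mul, integral_exp_neg_mul_cosh_mul_exp hint, Real.div_rpow hz.le zero_le_two,
    Real.rpow_sub two_pos, Real.rpow_one]
  ring

theorem isGaussianMixture_maternKernel {ν : ℝ} (hν : 0 < ν) :
    IsGaussianMixture (maternKernel ν) (gammaMeasure ν 1) fun v => ν / v where
  prob := isProbabilityMeasure_gammaMeasure hν one_pos
  meas := by fun_prop
  pos := (ae_pos_gammaMeasure ν).mono fun v hv => div_pos hν hv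
  eq d hd := by
    have := isProbabilityMeasure_gammaMeasure hν one_pos
    rcases hd.eq_or_lt' with rfl | hd
    · simp [maternKernel]
    have hs : Real.sqrt ν ^ 2 = ν := Real.sq_sqrt hν.le
    have hz : 0 < 2 * Real.sqrt ν * d := by positivity
    have e : (2 * Real.sqrt ν * d) ^ 2 / 4 = ν * d ^ 2 := by
      rw [mul_pow, mul_pow, hs]
      ring
    rw [maternKernel, if_neg hd.ne', integral_gammaMeasure_one hν, mul_assoc, mul_assoc,
      ← mul_assoc ((2 : ℝ) ^ (1 - ν)), rpow_mul_besselK_eq_integral hν hz, e]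
    congr 1
    refine setIntegral_congr_fun measurableSet_Ioi fun v _ => ?_
    simp only [div_mul_eq_mul_div]

theorem integrable_id_gammaMeasure {ν : ℝ} (hν : 0 < ν) :
    Integrable (fun v : ℝ => v) (gammaMeasure ν 1) := by
  refine .of_integral_ne_zero ?_
  have h : ∫ v in Set.Ioi (0 : ℝ), v ^ (ν - 1) * Real.exp (-v) * v = Real.Gamma (ν + 1) := by
    rw [Real.Gamma_eq_integral (by linarith)]
    refine setIntegral_congr_fun measurableSet_Ioi fun v hv => ?_
    have hv : 0 < v := hv
    simp only [add_sub_cancel_right]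
    rw [Real.rpow_sub_one hv.ne']
    field_simp
  rw [integral_gammaMeasure_one hν, h]
  have := Real.Gamma_pos_of_pos hν
  have := Real.Gamma_pos_of_pos (by linarith : 0 < ν + 1)
  positivity

theorem hasDerivAt_rationalQuadraticKernel (ν d : ℝ) {θ : ℝ} (hθ : 0 < θ) :
    HasDerivAt (fun t => rationalQuadraticKernel ν (d / t))
      (2 * ν / θ * ((d / θ) ^ 2 / (1 + (d / θ) ^ 2)) * (1 + (d / θ) ^ 2) ^ (-ν)) θ := by
  have h1 : HasDerivAt (fun t : ℝ => d / t) (-d / θ ^ 2) θ := by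
    refine ((hasDerivAt_inv hθ.ne').const_mul d).congr_deriv ?_
    ring
  have hp : 0 < 1 + (d / θ) ^ 2 := by positivity
  refine (((h1.pow 2).const_add 1).rpow_const (p := -ν) (Or.inl hp.ne')).congr_deriv ?_
  simp only [Pi.pow_apply, Nat.cast_ofNat, Nat.add_one_sub_one, pow_one]
  rw [Real.rpow_sub_one hp.ne']
  field_simp

/-- Here `E[1/g]` is infinite for `ν ≤ 1`, so the closed form of the derivative is used instead.
With `u = d / θ`, the crude bound `1 + u² ≥ u` already yields the power `θ ^ (ν - 1)`. -/
theorem abs_corrMatrixDeriv_rationalQuadraticKernel_le {r n : ℕ} {ν : ℝ} (hν : 0 < ν)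
    (x : Fin n → EuclideanSpace ℝ (Fin r)) (i j : Fin n) :
    ∃ B : ℝ, ∀ θ, 0 < θ →
      |corrMatrixDeriv (rationalQuadraticKernel ν) x θ i j| ≤ B * θ ^ (ν - 1) := by
  have hderiv {θ : ℝ} (hθ : 0 < θ) := (hasDerivAt_rationalQuadraticKernel ν ‖x i - x j‖ hθ).deriv
  simp only [corrMatrixDeriv, corrMatrix, Matrix.of_apply]
  rcases (norm_nonneg (x i - x j)).eq_or_lt' with h0 | hd
  · refine ⟨0, fun θ hθ => ?_⟩
    rw [hderiv hθ, h0]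
    simp
  refine ⟨2 * ν * (‖x i - x j‖ ^ ν)⁻¹, fun θ hθ => ?_⟩
  rw [hderiv hθ]
  generalize ‖x i - x j‖ = d at hd
  have hu : 0 < d / θ := by positivity
  have hp : 0 < 1 + (d / θ) ^ 2 := by positivity
  have h1 : (d / θ) ^ 2 / (1 + (d / θ) ^ 2) ≤ 1 := by
    rw [div_le_one hp]
    linarith
  have h2 : (1 + (d / θ) ^ 2) ^ (-ν) ≤ (d / θ) ^ (-ν) :=
    Real.rpow_le_rpow_of_nonpos hu (by nlinarith [sq_nonneg (d / θ - 1)]) (by linarith)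
  have h3 : 0 ≤ (1 + (d / θ) ^ 2) ^ (-ν) := (Real.rpow_pos_of_pos hp _).le
  rw [abs_of_nonneg (by positivity)]
  calc 2 * ν / θ * ((d / θ) ^ 2 / (1 + (d / θ) ^ 2)) * (1 + (d / θ) ^ 2) ^ (-ν)
      ≤ 2 * ν / θ * 1 * (d / θ) ^ (-ν) := by gcongr
    _ = 2 * ν * (d ^ ν)⁻¹ * θ ^ (ν - 1) := by
        rw [Real.rpow_neg hu.le, Real.div_rpow hd.le hθ.le, Real.rpow_sub_one hθ.ne']
        field_simp

theorem isBigO_inv_id_atTop : (fun θ : ℝ => θ⁻¹) =O[atTop] fun θ : ℝ => θ := by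
  refine IsBigO.of_bound 1 ?_
  filter_upwards [eventually_ge_atTop 1] with θ hθ
  have h0 : 0 < θ := by linarith
  rw [one_mul, Real.norm_eq_abs, Real.norm_eq_abs, abs_of_pos h0, abs_of_pos (inv_pos.mpr h0)]
  exact (inv_le_one_of_one_le₀ hθ).trans hθ

theorem mainTheorem2 {r n p : ℕ} (hr : 0 < r) (hpn : p < n)
    (x : Fin n → EuclideanSpace ℝ (Fin r)) (hx : Function.Injective x)
    (f : Fin p → EuclideanSpace ℝ (Fin r) → ℝ) (hH : (designMatrix f x).rank = p) :
    (∀ ν : ℝ, 1 ≤ ν →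
      ReferencePriorWellDefined (maternKernel ν) x (designMatrix f x) ∧
      ∀ π : ℝ → ℝ, IsMarginalReferencePrior (maternKernel ν) x (designMatrix f x) π →
        π =o[𝓝[>] (0 : ℝ)] (fun _ => (1 : ℝ)) ∧
        π =O[atTop] (fun θ : ℝ => θ⁻¹)) ∧
    (∀ ν : ℝ, 0 < ν →
      ReferencePriorWellDefined (rationalQuadraticKernel ν) x (designMatrix f x) ∧
      ∀ π : ℝ → ℝ, IsMarginalReferencePrior (rationalQuadraticKernel ν) x (designMatrix f x) π →
        π =O[𝓝[>] (0 : ℝ)] (fun θ : ℝ => θ ^ (ν - 1)) ∧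
        π =o[atTop] (fun _ => (1 : ℝ))) ∧
    (ReferencePriorWellDefined squaredExponentialKernel x (designMatrix f x) ∧
      ∀ π : ℝ → ℝ, IsMarginalReferencePrior squaredExponentialKernel x (designMatrix f x) π →
        π =o[𝓝[>] (0 : ℝ)] (fun _ => (1 : ℝ)) ∧
        π =O[atTop] (fun θ : ℝ => θ)) := by

  refine ⟨fun ν hν => ?_, fun ν hν => ?_, ?_⟩
  · have hν0 : 0 < ν := by linarith
    have h := isGaussianMixture_maternKernel hν0
    refine ⟨h.referencePriorWellDefined hpn hx hH, fun π hπ =>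
      ⟨h.prior_isLittleO_nhdsGT_zero ?_ hpn hx hH hπ, h.prior_isBigO_atTop hpn hx hH hπ⟩⟩
    -- For the Matérn kernel `1 / g` is `v / ν`, so `E[1/g]` is a multiple of the mean of the Gamma
    -- law.
    simp only [inv_div]
    exact (integrable_id_gammaMeasure hν0).div_const ν
  · have h := isGaussianMixture_rationalQuadraticKernel hν
    refine ⟨h.referencePriorWellDefined hpn hx hH, fun π hπ =>
      ⟨h.prior_isBigO_nhdsGT_zero hpn hx hH hπ (fun θ hθ => Real.rpow_nonneg hθ.le _)
        (abs_corrMatrixDeriv_rationalQuadraticKernel_le hν x),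
      (h.prior_isBigO_atTop hpn hx hH hπ).trans_isLittleO
        ((isLittleO_one_iff ℝ).mpr tendsto_inv_atTop_zero)⟩⟩
  · have h := isGaussianMixture_squaredExponentialKernel
    have := h.prob
    exact ⟨h.referencePriorWellDefined hpn hx hH, fun π hπ =>
      ⟨h.prior_isLittleO_nhdsGT_zero (integrable_const _) hpn hx hH hπ,
        (h.prior_isBigO_atTop hpn hx hH hπ).trans isBigO_inv_id_atTop⟩⟩
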